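/- Let $p$ be a prime, $q = 2^p$ and $G = \mathrm{PSL}(2,q)$. For $x \in G$ let $\mathrm{Sol}_G(x) = \{y \in G : \langle x,y\rangle \text{ is soluble}\}$. Write $C_n$ for the cyclic group of order $n$, $D_{2n}$ for the dihedral group of order $2n$, and $C_2^p \rtimes C_{q-1}$ for the semidirect product with $C_{q-1}$ acting faithfully on $C_2^p$. Then every maximal subgroup of $G$ is isomorphic to $C_2^p \rtimes C_{q-1}$, $D_{2(q-1)}$ or $D_{2(q+1)}$. Moreover, for every $x \in G$ with $x \neq 1$, $\mathrm{Sol}_G(x)$ is the union of the maximal subgroups of $G$ containing $x$, exactly one of the conditions $|x| = 2$, $|x| \mid q-1$, $|x| \mid q+1$ holds, and: 1. If $|x| = 2$, then $x$ lies in exactly $1$ maximal subgroup isomorphic to $C_2^p \rtimes C_{q-1}$, exactly $q/2$ isomorphic to $D_{2(q-1)}$ and exactly $q/2$ isomorphic to $D_{2(q+1)}$; any two distinct maximal subgroups containing $x$ intersect in a group isomorphic to $C_2$; and $|\mathrm{Sol}_G(x)| = 3q(q-1)$. 2. If $|x| \mid q-1$, then $x$ lies in exactly $2$ maximal subgroups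 isomorphic to $C_2^p \rtimes C_{q-1}$, exactly $1$ isomorphic to $D_{2(q-1)}$ and none isomorphic to $D_{2(q+1)}$; any two distinct maximal subgroups containing $x$ intersect in a group isomorphic to $C_{q-1}$; and $|\mathrm{Sol}_G(x)| = 2q(q-1)$. 3. If $|x| \mid q+1$, then $x$ lies in no maximal subgroup isomorphic to $C_2^p \rtimes C_{q-1}$ or $D_{2(q-1)}$ and in exactly $1$ isomorphic to $D_{2(q+1)}$, which is the only maximal subgroup containing $x$ (so there are no pairwise intersections); and $|\mathrm{Sol}_G(x)| = 2(q+1)$. -/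

import Mathlib

namespace Solubilizer

/-- The solubilizer `Sol_G(x)`: all `y` such that the subgroup `⟨x, y⟩` is soluble. -/
def solubilizer {G : Type*} [Group G] (x : G) : Set G :=
  {y | Group.IsSolvable (Subgroup.closure ({x, y} : Set G))}

/-- `H` is isomorphic to the cyclic group `C_n` (used for `n ≥ 1`). -/
def IsCyclicType (n : ℕ) (H : Type*) [Group H] : Prop :=
  Nonempty (H ≃* Multiplicative (ZMod n))

/-- `H` is isomorphic to the dihedral group `D_{2n}` of order `2n` (used for `n ≥ 3`);
`DihedralGroup n` is the symmetry group of the regular `n`-gon. -/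
def IsDihedralType (n : ℕ) (H : Type*) [Group H] : Prop :=
  Nonempty (H ≃* DihedralGroup n)

/-- `H` is isomorphic to a semidirect product `C_2^p ⋊ C_{2^p-1}` with `C_{2^p-1}` acting
faithfully on the elementary abelian group `C_2^p`. -/
def IsBorelType (p : ℕ) (H : Type*) [Group H] : Prop :=
  ∃ φ : Multiplicative (ZMod (2 ^ p - 1)) →* MulAut (Fin p → Multiplicative (ZMod 2)),
    Function.Injective φ ∧
      Nonempty (H ≃* (Fin p → Multiplicative (ZMod 2)) ⋊[φ] Multiplicative (ZMod (2 ^ p - 1)))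

/-- The set of maximal subgroups of `G` that contain `x`. -/
def maximalContaining {G : Type*} [Group G] (x : G) : Set (Subgroup G) :=
  {M | IsCoatom M ∧ x ∈ M}

end Solubilizer

namespace EvenSL2

/-! ### Matrix computations in SL(2, F): centralizers, involutions, inversion -/

section Matrices

open Matrix

variable {F : Type*} [Field F]

local notation "SL₂" => SpecialLinearGroup (Fin 2) F

/-! In characteristic two SL(2, q) has trivial centre, so PSL may be replaced by SL. A matrix
commuting with x ≠ 1 has the form a + bx. Hence commuting is transitive on non-identity elements,
and the centralizers of these partition them. If x ≠ 1 has trace zero, then x² = 1 and the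
centralizer is elementary abelian of order q; otherwise the centralizer is a cyclic torus of order q
- 1 or q + 1, inverted by an involution. Facts of this kind are collected in `IsEvenSL2`, and
everything afterwards is deduced from them alone.

The heart is `exists_le_normCent`: a proper subgroup H normalizes the centralizer of some x ≠ 1. If
H has no involution, counting conjugates shows that H is abelian. If all involutions of H commute, H
normalizes the centralizer of any of them. Otherwise the involutions of H form one class, and c =
|C_H(u)| satisfies (c - 1)c ∣ (q - 1)q; since p is prime, c is 2 or q. The value 2 puts H in the
normalizer of a torus, and q forces H = G. So the maximal subgroups are exactly the normalizers of
centralizers: Borel subgroups for involutions, dihedral groups for tori. They are soluble and G is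
not, whence the solubilizer of x is the union of the maximal subgroups containing x.

For the counts, Burnside's lemma on the q + 1 Borel subgroups shows that a torus of order q - 1 lies
in exactly two of them. Double counting then gives q/2 such tori inverted by a given involution, and
counting all elements inverted by it gives q/2 tori of order q + 1. When several maximal subgroups
contain x, they meet pairwise in one common core, {1, x} or the torus of x, so the size of their
union is a sum over disjoint remainders. -/

theorem sl_ext {x y : SL₂} (h00 : x 0 0 = y 0 0) (h01 : x 0 1 = y 0 1) (h10 : x 1 0 = y 1 0)
    (h11 : x 1 1 = y 1 1) : x = y := by
  ext i j
  fin_cases i <;> fin_cases j <;> assumption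

theorem sl_det (x : SL₂) : x 0 0 * x 1 1 - x 0 1 * x 1 0 = 1 := by
  rw [← Matrix.det_fin_two]; exact x.2

theorem sl_mul_apply (x y : SL₂) (i j : Fin 2) :
    (x * y) i j = x i 0 * y 0 j + x i 1 * y 1 j := by
  simp [Matrix.mul_apply, Fin.sum_univ_two]

theorem sl_inv (x : SL₂) :
    x⁻¹ 0 0 = x 1 1 ∧ x⁻¹ 0 1 = - x 0 1 ∧ x⁻¹ 1 0 = - x 1 0 ∧ x⁻¹ 1 1 = x 0 0 := by
  simp [Matrix.adjugate_fin_two]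

theorem sl_one_apply : (1 : SL₂) 0 0 = 1 ∧ (1 : SL₂) 0 1 = 0 ∧ (1 : SL₂) 1 0 = 0 ∧
    (1 : SL₂) 1 1 = 1 := by
  simp

variable [CharP F 2]

theorem sl_ne_one {x : SL₂} (hx : x ≠ 1) : x 0 1 ≠ 0 ∨ x 1 0 ≠ 0 ∨ x 0 0 ≠ x 1 1 := by
  by_contra! h
  obtain ⟨h1, h2, h3⟩ := h
  have hd := sl_det x
  rw [h1, h3] at hd
  have : x 1 1 = 1 := by
    have : (x 1 1 + 1) ^ 2 = 0 := by
      linear_combination hd + (x 1 1 + 1) * CharTwo.two_eq_zero (R := F)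
    have := pow_eq_zero_iff (two_ne_zero) |>.1 this
    rwa [CharTwo.add_eq_zero] at this
  exact hx (sl_ext (by simp [h3, this]) (by simp [h1]) (by simp [h2]) (by simp [this]))

/-- An element commuting with `x ≠ 1` is a linear combination of `1` and `x`. -/
theorem sl_commute_iff {x : SL₂} (hx : x ≠ 1) (y : SL₂) :
    Commute x y ↔ ∃ a b : F, y 0 0 = a + b * x 0 0 ∧ y 0 1 = b * x 0 1 ∧ y 1 0 = b * x 1 0 ∧
      y 1 1 = a + b * x 1 1 := by
  constructor
  · intro h
    have e (i j : Fin 2) : (x * y) i j = (y * x) i j := by rw [h.eq]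
    simp only [sl_mul_apply] at e
    have e00 := e 0 0
    have e01 := e 0 1
    have e10 := e 1 0
    have e11 := e 1 1
    rcases sl_ne_one hx with h1 | h1 | h1
    · refine ⟨y 0 0 - y 0 1 / x 0 1 * x 0 0, y 0 1 / x 0 1, by ring, by field_simp, ?_, ?_⟩
      · field_simp; linear_combination e00
      · field_simp; linear_combination e01
    · refine ⟨y 0 0 - y 1 0 / x 1 0 * x 0 0, y 1 0 / x 1 0, by ring, ?_, by field_simp, ?_⟩
      · field_simp; linear_combination -e00
      · field_simp; linear_combination -e10
    · have h2 : x 0 0 - x 1 1 ≠ 0 := sub_ne_zero.2 h1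
      refine ⟨y 0 0 - (y 0 0 - y 1 1) / (x 0 0 - x 1 1) * x 0 0,
        (y 0 0 - y 1 1) / (x 0 0 - x 1 1), by ring, ?_, ?_, ?_⟩
      · field_simp; linear_combination e01
      · field_simp; linear_combination -e10
      · field_simp; ring
  · rintro ⟨a, b, h1, h2, h3, h4⟩
    refine sl_ext ?_ ?_ ?_ ?_ <;> simp only [sl_mul_apply, h1, h2, h3, h4] <;> ring

theorem sl_comm_trans {x y z : SL₂} (hx : x ≠ 1) (hy : Commute x y) (hz : Commute x z) :
    Commute y z := by
  obtain ⟨a, b, h1, h2, h3, h4⟩ := (sl_commute_iff hx y).1 hy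
  obtain ⟨c, d, k1, k2, k3, k4⟩ := (sl_commute_iff hx z).1 hz
  refine sl_ext ?_ ?_ ?_ ?_ <;> simp only [sl_mul_apply, h1, h2, h3, h4, k1, k2, k3, k4] <;> ring

/-- By Cayley–Hamilton x² = tx - 1, and in characteristic two the trace t vanishes exactly when the
diagonal entries agree. -/
theorem sl_sq_iff (x : SL₂) : x * x = 1 ↔ x 0 0 = x 1 1 := by
  have hd := sl_det x
  have h2 := CharTwo.two_eq_zero (R := F)
  constructor
  · intro h
    by_contra hne
    have e (i j : Fin 2) : (x * x) i j = (1 : SL₂) i j := by rw [h]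
    obtain ⟨o1, o2, o3, o4⟩ := sl_one_apply (F := F)
    have e00 := e 0 0
    have e01 := e 0 1
    have e10 := e 1 0
    have e11 := e 1 1
    simp only [sl_mul_apply, o1, o2, o3, o4] at e00 e01 e10 e11
    have hs : (x 0 0 - x 1 1) ≠ 0 := sub_ne_zero.2 hne
    have := mul_self_ne_zero.2 hs
    apply this
    linear_combination e00 + e11 - 2 * hd + (-2 * x 0 1 * x 1 0) * h2
  · intro h
    obtain ⟨o1, o2, o3, o4⟩ := sl_one_apply (F := F)
    refine sl_ext ?_ ?_ ?_ ?_ <;> simp only [sl_mul_apply, o1, o2, o3, o4, h] <;> rw [h] at hd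
    · linear_combination hd + x 0 1 * x 1 0 * h2
    · linear_combination x 0 1 * x 1 1 * h2
    · linear_combination x 1 0 * x 1 1 * h2
    · linear_combination hd + x 0 1 * x 1 0 * h2

theorem sl_sq_of_commute {u y : SL₂} (hu : u ≠ 1) (h : u * u = 1) (hy : Commute u y) :
    y * y = 1 := by
  rw [sl_sq_iff] at h ⊢
  obtain ⟨a, b, h1, h2, h3, h4⟩ := (sl_commute_iff hu y).1 hy
  rw [h1, h4, h]

/-- The centralizer of `x ≠ 1` is the set of points of a conic. -/
theorem card_centralizer_eq_card_conic {x : SL₂} (hx : x ≠ 1) :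
    Nat.card (Subgroup.centralizer {x}) =
      Nat.card {c : F × F // c.1 ^ 2 + (x 0 0 + x 1 1) * c.1 * c.2 + c.2 ^ 2 = 1} := by
  have hd := sl_det x
  symm
  let f (c : {c : F × F // c.1 ^ 2 + (x 0 0 + x 1 1) * c.1 * c.2 + c.2 ^ 2 = 1}) : SL₂ :=
    ⟨!![c.1.1 + c.1.2 * x 0 0, c.1.2 * x 0 1; c.1.2 * x 1 0, c.1.1 + c.1.2 * x 1 1], by
      have := c.2
      rw [Matrix.det_fin_two_of]
      linear_combination this + c.1.2 ^ 2 * hd⟩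
  refine Nat.card_congr (Equiv.ofBijective
    (fun c ↦ ⟨f c, Subgroup.mem_centralizer_singleton_iff.2
      ((sl_commute_iff hx (f c)).2 ⟨c.1.1, c.1.2, by simp [f], by simp [f], by simp [f],
        by simp [f]⟩).symm⟩) ⟨?_, ?_⟩)
  · rintro ⟨⟨a, b⟩, h⟩ ⟨⟨c, d⟩, k⟩ hfg
    have e (i j : Fin 2) : f ⟨⟨a, b⟩, h⟩ i j = f ⟨⟨c, d⟩, k⟩ i j := by
      rw [Subtype.mk.injEq] at hfg; rw [hfg]
    have e00 := e 0 0
    have e01 := e 0 1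
    have e10 := e 1 0
    have e11 := e 1 1
    simp [f] at e00 e01 e10 e11
    have hbd : b = d := by
      rcases sl_ne_one hx with h1 | h1 | h1
      · exact e01.resolve_right h1
      · exact e10.resolve_right h1
      · apply mul_right_cancel₀ (sub_ne_zero.2 h1)
        linear_combination e00 - e11
    subst hbd
    have : a = c := by simpa using e00
    simp [this]
  · rintro ⟨y, hy⟩
    obtain ⟨a, b, h1, h2, h3, h4⟩ := (sl_commute_iff hx y).1
      (Subgroup.mem_centralizer_singleton_iff.1 hy).symm
    have hy := sl_det y
    rw [h1, h2, h3, h4] at hy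
    refine ⟨⟨⟨a, b⟩, by linear_combination hy - b ^ 2 * hd⟩, ?_⟩
    simp only [Subtype.mk.injEq]
    refine sl_ext ?_ ?_ ?_ ?_ <;> simp [f, *]

theorem add_self_mul_eq_one_iff {a b : F} : (a + b) ^ 2 = 1 ↔ a = 1 + b := by
  constructor
  · intro h
    have : (a + b + 1) ^ 2 = 0 := by
      linear_combination h + (a + b + 1) * CharTwo.two_eq_zero (R := F)
    have := pow_eq_zero_iff (two_ne_zero) |>.1 this
    linear_combination this - (1 + b) * CharTwo.two_eq_zero (R := F)
  · rintro rfl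
    linear_combination (2 * b + 2 * b ^ 2) * CharTwo.two_eq_zero (R := F)

theorem card_conic_zero :
    Nat.card {c : F × F // c.1 ^ 2 + 0 * c.1 * c.2 + c.2 ^ 2 = 1} = Nat.card F := by
  have key (c : F × F) : c.1 ^ 2 + 0 * c.1 * c.2 + c.2 ^ 2 = 1 ↔ c.1 = 1 + c.2 := by
    rw [← add_self_mul_eq_one_iff, CharTwo.add_sq, zero_mul, zero_mul, add_zero]
  refine Nat.card_congr ⟨fun c ↦ c.1.2, fun b ↦ ⟨(1 + b, b), (key _).2 rfl⟩, ?_, fun b ↦ rfl⟩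
  rintro ⟨⟨a, b⟩, h⟩
  have := (key _).1 h
  simp_all

/-- Stereographic projection from the point (1, 0). The line a = 1 + rb meets the conic again at b =
t / (r² + tr + 1), unless r is a root of the denominator. The remaining line b = 0 is the tangent
and accounts for (1, 0) itself, which is the `none` of the option type. -/
theorem card_conic [Finite F] {t : F} (ht : t ≠ 0) :
    Nat.card {c : F × F // c.1 ^ 2 + t * c.1 * c.2 + c.2 ^ 2 = 1} +
      Nat.card {r : F // r ^ 2 + t * r + 1 = 0} = Nat.card F + 1 := by
  have h2 := CharTwo.two_eq_zero (R := F)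
  have e : {c : F × F // c.1 ^ 2 + t * c.1 * c.2 + c.2 ^ 2 = 1} ≃
      Option {r : F // ¬ (r ^ 2 + t * r + 1 = 0)} := by
    classical
    refine Equiv.symm (Equiv.ofBijective (fun o ↦ o.elim ⟨(1, 0), by simp⟩ fun r ↦
      ⟨(1 + r.1 * (t / (r.1 ^ 2 + t * r.1 + 1)), t / (r.1 ^ 2 + t * r.1 + 1)), ?_⟩) ⟨?_, ?_⟩)
    · obtain ⟨r, hr⟩ := r
      obtain ⟨D, hD⟩ : ∃ D, r ^ 2 + t * r + 1 = D := ⟨_, rfl⟩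
      rw [hD] at hr
      simp only [hD]
      field_simp
      linear_combination t ^ 2 * hD + (D * r * t + t ^ 2 * D) * h2
    · rintro (_ | ⟨r, hr⟩) (_ | ⟨s, hs⟩) h
      · rfl
      · exact absurd (congrArg (fun c ↦ c.1.2) h).symm (div_ne_zero ht hs)
      · exact absurd (congrArg (fun c ↦ c.1.2) h) (div_ne_zero ht hr)
      · simp only [Option.elim_some, Subtype.mk.injEq, Prod.mk.injEq] at h
        obtain ⟨h, h'⟩ := h
        rw [h'] at h
        have : t / (s ^ 2 + t * s + 1) ≠ 0 := div_ne_zero ht hs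
        have := mul_right_cancel₀ this (add_left_cancel h)
        subst this
        rfl
    · rintro ⟨⟨a, b⟩, h⟩
      by_cases hb : b = 0
      · subst hb
        refine ⟨none, ?_⟩
        have : (a + 0) ^ 2 = 1 := by simpa using h
        have := add_self_mul_eq_one_iff.1 this
        simp_all
      · simp only at h
        have key : ((a + 1) / b) ^ 2 + t * ((a + 1) / b) + 1 = t / b := by
          field_simp
          linear_combination h + (1 + a) * h2
        refine ⟨some ⟨(a + 1) / b, by rw [key]; exact div_ne_zero ht hb⟩, ?_⟩
        simp only [Option.elim_some, Subtype.mk.injEq, Prod.mk.injEq, key]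
        constructor
        · field_simp
          linear_combination h2
        · field_simp
  classical
  rw [Nat.card_congr e, Finite.card_option, ← Nat.card_congr (Equiv.sumCompl
    (fun r : F ↦ r ^ 2 + t * r + 1 = 0)), Nat.card_sum]
  ring

/-- Translation by t permutes the roots without fixed points, and a quadratic has at most two roots.
-/
theorem card_roots {t : F} (ht : t ≠ 0) :
    Nat.card {r : F // r ^ 2 + t * r + 1 = 0} = 0 ∨
      Nat.card {r : F // r ^ 2 + t * r + 1 = 0} = 2 := by
  have h2 := CharTwo.two_eq_zero (R := F)
  by_cases h : ∃ r : F, r ^ 2 + t * r + 1 = 0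
  · right
    obtain ⟨r, hr⟩ := h
    have : {r : F | r ^ 2 + t * r + 1 = 0} = {r, r + t} := by
      ext s
      simp only [Set.mem_ofPred_eq, Set.mem_insert_iff, Set.mem_singleton_iff]
      constructor
      · intro hs
        have : (s - r) * (s - (r + t)) = 0 := by
          linear_combination hs + hr + (r ^ 2 - r ^ 2 -1 - r * s - t * s) * h2
        rcases mul_eq_zero.1 this with h | h
        · left; exact sub_eq_zero.1 h
        · right; exact sub_eq_zero.1 h
      · rintro (rfl | rfl)
        · exact hr
        · linear_combination hr + (t * r + t ^ 2) * h2
    change Nat.card ({r : F | r ^ 2 + t * r + 1 = 0} : Set F) = 2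
    rw [this, Nat.card_coe_set_eq, Set.ncard_pair]
    simpa using ht
  · left
    push Not at h
    rw [Nat.card_eq_zero]
    left
    exact ⟨fun r ↦ h r.1 r.2⟩

theorem sl_trace_ne_zero {x : SL₂} (hx : x * x ≠ 1) : x 0 0 + x 1 1 ≠ 0 := by
  rw [Ne, sl_sq_iff] at hx
  rwa [Ne, CharTwo.add_eq_zero]

theorem ne_one_of_mul_self_ne {G : Type*} [Group G] {x : G} (hx : x * x ≠ 1) : x ≠ 1 := by
  rintro rfl; simp at hx

theorem sl_card_centralizer_of_sq {u : SL₂} (hu : u ≠ 1) (h : u * u = 1) :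
    Nat.card (Subgroup.centralizer {u}) = Nat.card F := by
  rw [card_centralizer_eq_card_conic hu, (sl_sq_iff u).1 h, CharTwo.add_self_eq_zero,
    card_conic_zero]

theorem sl_card_centralizer [Finite F] {x : SL₂} (hx : x * x ≠ 1) :
    Nat.card (Subgroup.centralizer {x}) = Nat.card F - 1 ∨
      Nat.card (Subgroup.centralizer {x}) = Nat.card F + 1 := by
  rw [card_centralizer_eq_card_conic (ne_one_of_mul_self_ne hx)]
  have := card_conic (sl_trace_ne_zero hx)
  rcases card_roots (sl_trace_ne_zero hx) with h | h <;> omega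

/-- It suffices that w and wx both have square 1, that is, trace zero. With w = (e f; g e) these
become the determinant equation and one linear equation in e, f, g. -/
theorem sl_exists_inverting {x : SL₂} (hx : x * x ≠ 1) :
    ∃ w : SL₂, w * w = 1 ∧ w * x * w⁻¹ = x⁻¹ := by
  have h2 := CharTwo.two_eq_zero (R := F)
  set t := x 0 0 + x 1 1 with htdef
  have ht : t ≠ 0 := sl_trace_ne_zero hx
  have key : ∃ e f g : F, e ^ 2 + f * g = 1 ∧ e * t + f * x 1 0 + g * x 0 1 = 0 := by
    by_cases h10 : x 1 0 = 0
    · by_cases h01 : x 0 1 = 0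
      · exact ⟨0, 1, 1, by ring, by rw [h10, h01]; ring⟩
      · refine ⟨1, 0, t / x 0 1, by ring, ?_⟩
        field_simp
        linear_combination t * h2
    · refine ⟨1, t / x 1 0, 0, by ring, ?_⟩
      field_simp
      linear_combination t * h2
  obtain ⟨e, f, g, h1, h3⟩ := key
  let w : SL₂ := ⟨!![e, f; g, e], by
    rw [Matrix.det_fin_two_of]; linear_combination h1 - f * g * h2⟩
  have hw : w * w = 1 := (sl_sq_iff w).2 (by simp [w])
  refine ⟨w, hw, ?_⟩
  have hwx : (w * x) * (w * x) = 1 := by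
    rw [sl_sq_iff]
    simp only [sl_mul_apply]
    simp only [w, Matrix.of_apply, Matrix.cons_val', Matrix.cons_val_zero,
      Matrix.cons_val_one, Matrix.cons_val_fin_one]
    rw [htdef] at h3
    linear_combination h3 - (e * x 1 1 + g * x 0 1) * h2
  have hinv : w⁻¹ = w := inv_eq_of_mul_eq_one_left hw
  rw [hinv]
  exact eq_inv_of_mul_eq_one_left (by rw [← hwx]; group)

/-- The conjugate has the form a + bx. Comparing traces gives b = 1, and comparing determinants
gives a(a + t) = 0; the two roots are x and t + x = x⁻¹. -/
theorem sl_conj_eq {x g : SL₂} (hx : x * x ≠ 1) (h : Commute x (g * x * g⁻¹)) :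
    g * x * g⁻¹ = x ∨ g * x * g⁻¹ = x⁻¹ := by
  have h2 := CharTwo.two_eq_zero (R := F)
  have ht : x 0 0 + x 1 1 ≠ 0 := sl_trace_ne_zero hx
  set y := g * x * g⁻¹ with hy
  have htr : y 0 0 + y 1 1 = x 0 0 + x 1 1 := by
    obtain ⟨i1, i2, i3, i4⟩ := sl_inv g
    simp only [hy, sl_mul_apply, i1, i2, i3, i4]
    linear_combination (x 0 0 + x 1 1) * sl_det g
  obtain ⟨a, b, e1, e2, e3, e4⟩ := (sl_commute_iff (ne_one_of_mul_self_ne hx) y).1 h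
  have hb : b = 1 := by
    rw [e1, e4] at htr
    apply mul_right_cancel₀ ht
    linear_combination htr - a * h2
  subst hb
  have hdx := sl_det x
  have hdy := sl_det y
  rw [e1, e2, e3, e4] at hdy
  have : a * (a + (x 0 0 + x 1 1)) = 0 := by linear_combination hdy - hdx
  rcases mul_eq_zero.1 this with h | h
  · left
    subst h
    exact sl_ext (by rw [e1]; ring) (by rw [e2]; ring) (by rw [e3]; ring) (by rw [e4]; ring)
  · right
    obtain ⟨i1, i2, i3, i4⟩ := sl_inv x
    refine sl_ext ?_ ?_ ?_ ?_
    · rw [e1, i1]; linear_combination h - x 1 1 * h2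
    · rw [e2, i2]; linear_combination x 0 1 * h2
    · rw [e3, i3]; linear_combination x 1 0 * h2
    · rw [e4, i4]; linear_combination h - x 0 0 * h2

/-- The off-diagonal entries f, g are free, and the repeated diagonal entry is the unique square
root of 1 + fg, since Frobenius is bijective. -/
theorem sl_card_sq [Finite F] : Nat.card {u : SL₂ // u * u = 1} = Nat.card F ^ 2 := by
  have h2 := CharTwo.two_eq_zero (R := F)
  have hs (a : F) : ∃ e : F, e ^ 2 = a := by
    have := (Finite.injective_iff_surjective (f := fun e : F ↦ e ^ 2)).1 (frobenius_inj F 2)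
    exact this a
  have hinj {a b : F} (h : a ^ 2 = b ^ 2) : a = b := frobenius_inj F 2 h
  rw [pow_two, ← Nat.card_prod]
  refine Nat.card_congr (Equiv.ofBijective (fun u ↦ (u.1 0 1, u.1 1 0)) ⟨?_, ?_⟩)
  · rintro ⟨u, hu⟩ ⟨v, hv⟩ h
    simp only [Prod.mk.injEq] at h
    rw [sl_sq_iff] at hu hv
    have hdu := sl_det u
    have hdv := sl_det v
    have : u 1 1 = v 1 1 := by
      apply hinj
      rw [hu, h.1, h.2] at hdu
      rw [hv] at hdv
      linear_combination hdu - hdv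
    simp only [Subtype.mk.injEq]
    exact sl_ext (by rw [hu, hv, this]) h.1 h.2 this
  · rintro ⟨f, g⟩
    obtain ⟨e, he⟩ := hs (1 + f * g)
    exact ⟨⟨⟨!![e, f; g, e], by rw [Matrix.det_fin_two_of]; linear_combination he⟩,
      (sl_sq_iff _).2 (by simp)⟩, by simp⟩

end Matrices
-- Cyclic tori and generation by involution centralizers
section Matrices

open Matrix

variable {F : Type*} [Field F]

local notation "SL₂" => SpecialLinearGroup (Fin 2) F

theorem sl_exists_eigenvector (x : SL₂) : ∃ μ v w : AlgebraicClosure F, (v ≠ 0 ∨ w ≠ 0) ∧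
    algebraMap _ _ (x 0 0) * v + algebraMap _ _ (x 0 1) * w = μ * v ∧
    algebraMap _ _ (x 1 0) * v + algebraMap _ _ (x 1 1) * w = μ * w := by
  by_cases h01 : x 0 1 = 0
  · exact ⟨algebraMap _ _ (x 1 1), 0, 1, by simp, by simp [h01], by simp⟩
  let K := AlgebraicClosure F
  let ι : F →+* K := algebraMap F K
  have hdx := sl_det x
  obtain ⟨μ, hμ⟩ : ∃ μ : K, μ ^ 2 - ι (x 0 0 + x 1 1) * μ + 1 = 0 := by
    let P : Polynomial K := Polynomial.X ^ 2 - Polynomial.C (ι (x 0 0 + x 1 1)) * Polynomial.X + 1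
    have hP : P.degree ≠ 0 := by
      have : P.degree = 2 := by simp only [P]; compute_degree!
      rw [this]; decide
    obtain ⟨μ, hμ⟩ := IsAlgClosed.exists_root P hP
    exact ⟨μ, by simpa [P, Polynomial.IsRoot] using hμ⟩
  have hd : ι (x 0 0) * ι (x 1 1) - ι (x 0 1) * ι (x 1 0) = 1 := by
    rw [← map_mul, ← map_mul, ← map_sub, hdx, map_one]
  rw [map_add] at hμ
  refine ⟨μ, ι (x 0 1), μ - ι (x 0 0), Or.inl (by rwa [Ne, map_eq_zero]), by ring, ?_⟩
  change ι (x 1 0) * ι (x 0 1) + ι (x 1 1) * (μ - ι (x 0 0)) = _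
  linear_combination -hμ - hd

variable [CharP F 2]

/-- An eigenvector of x over the algebraic closure is an eigenvector of every a + bx, so the
eigenvalue is a character of the centralizer. It is injective: eigenvalue 1 and determinant 1 force
trace 2 = 0, while a + bx has trace bt, so b = 0 and the matrix is scalar. A finite group embedded
multiplicatively in a field is cyclic. -/
theorem sl_isCyclic_centralizer [Finite F] {x : SL₂} (hx : x * x ≠ 1) :
    IsCyclic (Subgroup.centralizer {x}) := by
  have h2 := CharTwo.two_eq_zero (R := F)
  let K := AlgebraicClosure F
  let ι : F →+* K := algebraMap F K
  have hι : Function.Injective ι := ι.injective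
  have ht := sl_trace_ne_zero hx
  have h2K : (2 : K) = 0 := by rw [← map_ofNat ι 2, h2, map_zero]
  obtain ⟨μ, v, w, hvw, e1, e2⟩ := sl_exists_eigenvector x
  have hC (y : Subgroup.centralizer {x}) := (sl_commute_iff (ne_one_of_mul_self_ne hx) y.1).1
    (Subgroup.mem_centralizer_singleton_iff.1 y.2).symm
  have hχ (y : Subgroup.centralizer {x}) : ∃ c : K,
      ι (y.1 0 0) * v + ι (y.1 0 1) * w = c * v ∧ ι (y.1 1 0) * v + ι (y.1 1 1) * w = c * w := by
    obtain ⟨a, b, h1, h2, h3, h4⟩ := hC y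
    refine ⟨ι a + ι b * μ, ?_, ?_⟩
    · rw [h1, h2]; simp only [map_add, map_mul]; linear_combination ι b * e1
    · rw [h3, h4]; simp only [map_add, map_mul]; linear_combination ι b * e2
  choose χ hχ1 hχ2 using hχ
  have huniq {c d : K} (h1 : c * v = d * v) (h2 : c * w = d * w) : c = d := by
    rcases hvw with h | h
    · exact mul_right_cancel₀ h h1
    · exact mul_right_cancel₀ h h2
  obtain ⟨o1, o2, o3, o4⟩ := sl_one_apply (F := F)
  let f : Subgroup.centralizer {x} →* K :=
    { toFun := χ
      map_one' := by
        have k1 := hχ1 1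
        have k2 := hχ2 1
        simp only [OneMemClass.coe_one, o1, o2, o3, o4, map_one, map_zero] at k1 k2
        exact huniq (by linear_combination -k1) (by linear_combination -k2)
      map_mul' := by
        intro y z
        have k1 := hχ1 (y * z)
        have k2 := hχ2 (y * z)
        simp only [Subgroup.coe_mul, sl_mul_apply, map_add, map_mul] at k1 k2
        apply huniq
        · linear_combination -k1 + ι (y.1 0 0) * hχ1 z + ι (y.1 0 1) * hχ2 z + χ z * hχ1 y
        · linear_combination -k2 + ι (y.1 1 0) * hχ1 z + ι (y.1 1 1) * hχ2 z + χ z * hχ2 y }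
  refine isCyclic_of_injective_ringHom f ((injective_iff_map_eq_one f).2 fun y hy ↦ ?_)
  have hy : χ y = 1 := hy
  have k1 := hχ1 y
  have k2 := hχ2 y
  rw [hy] at k1 k2
  obtain ⟨a, b, h1, h2', h3, h4⟩ := hC y
  have hd : (ι (y.1 0 0) - 1) * (ι (y.1 1 1) - 1) - ι (y.1 0 1) * ι (y.1 1 0) = 0 := by
    apply huniq
    · linear_combination (ι (y.1 1 1) - 1) * k1 - ι (y.1 0 1) * k2
    · linear_combination (ι (y.1 0 0) - 1) * k2 - ι (y.1 1 0) * k1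
  have hdy : ι (y.1 0 0) * ι (y.1 1 1) - ι (y.1 0 1) * ι (y.1 1 0) = 1 := by
    rw [← map_mul, ← map_mul, ← map_sub, sl_det y.1, map_one]
  have htr : y.1 0 0 + y.1 1 1 = 0 := by
    apply hι
    rw [map_add, map_zero]
    linear_combination hdy - hd + h2K
  have hb : b = 0 := by
    rw [h1, h4] at htr
    apply (mul_eq_zero.1 _).resolve_right ht
    linear_combination htr - a * h2
  subst hb
  by_contra hne
  rcases sl_ne_one (x := y.1) (fun h ↦ hne (Subtype.ext h)) with h | h | h
  · exact h (by rw [h2', zero_mul])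
  · exact h (by rw [h3, zero_mul])
  · exact h (by rw [h1, h4, zero_mul, zero_mul])

/-- A matrix of determinant 1 with non-zero lower left entry is determined up to left and right
multiplication by upper unitriangular matrices by that entry. The centralizer of v supplies every
value of the entry. A matrix with zero lower left entry leaves the upper triangular group after
multiplication by v. -/
theorem sl_upper_generate {v : SL₂} (hv : v 0 0 = v 1 1) (hv0 : v 1 0 ≠ 0)
    {H : Subgroup SL₂} (hU : ∀ y : SL₂, y 1 0 = 0 → y 0 0 = 1 → y 1 1 = 1 → y ∈ H)
    (hV : Subgroup.centralizer {v} ≤ H) : H = ⊤ := by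
  have h2 := CharTwo.two_eq_zero (R := F)
  have hne : v ≠ 1 := by rintro rfl; simp at hv0
  let U (a : F) : SL₂ := ⟨!![1, a; 0, 1], by simp [Matrix.det_fin_two_of]⟩
  have hUm (a : F) : U a ∈ H := hU _ (by simp [U]) (by simp [U]) (by simp [U])
  have key : ∀ y : SL₂, y 1 0 ≠ 0 → y ∈ H := by
    intro y hy
    set b := y 1 0 / v 1 0 with hb
    have hbv : b * v 1 0 = y 1 0 := by rw [hb]; field_simp
    -- This is (1 + b) + bv. As v has trace zero, its determinant is (1 + b)² + b² = 1.
    let z : SL₂ := ⟨!![1 + b + b * v 0 0, b * v 0 1; b * v 1 0, 1 + b + b * v 1 1], by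
      have hd := sl_det v
      rw [Matrix.det_fin_two_of]
      rw [hv] at hd ⊢
      linear_combination b ^ 2 * hd + (b + b ^ 2 + (b + b ^ 2) * v 1 1) * h2⟩
    have z00 : z 0 0 = 1 + b + b * v 0 0 := by simp [z]
    have z01 : z 0 1 = b * v 0 1 := by simp [z]
    have z10 : z 1 0 = b * v 1 0 := by simp [z]
    have z11 : z 1 1 = 1 + b + b * v 1 1 := by simp [z]
    have hz : z ∈ H := hV (Subgroup.mem_centralizer_singleton_iff.2
      ((sl_commute_iff hne z).2 ⟨1 + b, b, z00, z01, z10, z11⟩).symm)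
    have hyz : y = U ((y 0 0 - z 0 0) / y 1 0) * z * U ((y 1 1 - z 1 1) / y 1 0) := by
      have u00 (a : F) : U a 0 0 = 1 := by simp [U]
      have u01 (a : F) : U a 0 1 = a := by simp [U]
      have u10 (a : F) : U a 1 0 = 0 := by simp [U]
      have u11 (a : F) : U a 1 1 = 1 := by simp [U]
      have hz10 : z 1 0 = y 1 0 := by rw [z10, hbv]
      have hdy := sl_det y
      have hdz := sl_det z
      refine sl_ext ?_ ?_ ?_ ?_ <;> simp only [sl_mul_apply, u00, u01, u10, u11, hz10]
      · field_simp; ring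
      · rw [hz10] at hdz
        field_simp
        linear_combination hdz - hdy
      · ring
      · field_simp; ring
    rw [hyz]
    exact H.mul_mem (H.mul_mem (hUm _) hz) (hUm _)
  rw [eq_top_iff]
  intro y _
  by_cases hy : y 1 0 = 0
  · have hvH := key v hv0
    have : y * v ∈ H := key _ (by
      rw [sl_mul_apply, hy, zero_mul, zero_add]
      refine mul_ne_zero (fun h ↦ ?_) hv0
      have := sl_det y
      simp [h, hy] at this)
    simpa using H.mul_mem this (H.inv_mem hvH)
  · exact key y hy

end Matrices

/-! ### The abstract interface and its verification for SL and PSL -/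

/-- The group-theoretic properties of `SL(2, q)`, `q` even, on which its subgroup structure
depends. -/
structure IsEvenSL2 (q : ℕ) (G : Type*) [Group G] : Prop where
  comm_trans : ∀ x y z : G, x ≠ 1 → Commute x y → Commute x z → Commute y z
  sq_of_comm : ∀ u y : G, u ≠ 1 → u * u = 1 → Commute u y → y * y = 1
  card_of_sq : ∀ u : G, u ≠ 1 → u * u = 1 → Nat.card (Subgroup.centralizer {u}) = q
  isCyclic : ∀ x : G, x * x ≠ 1 → IsCyclic (Subgroup.centralizer {x})
  card_of_not_sq : ∀ x : G, x * x ≠ 1 → Nat.card (Subgroup.centralizer {x}) = q - 1 ∨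
    Nat.card (Subgroup.centralizer {x}) = q + 1
  exists_inverting : ∀ x : G, x * x ≠ 1 → ∃ w, w * w = 1 ∧ w * x * w⁻¹ = x⁻¹
  conj_eq : ∀ x g : G, x * x ≠ 1 → Commute x (g * x * g⁻¹) →
    g * x * g⁻¹ = x ∨ g * x * g⁻¹ = x⁻¹
  card_sq : Nat.card {u : G // u * u = 1} = q ^ 2
  exists_base : ∃ u : G, u ≠ 1 ∧ u * u = 1 ∧
    (∀ x y, x * x ≠ 1 → Commute u (x * u * x⁻¹) → Commute x y → Commute u (y * u * y⁻¹)) ∧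
    ∀ v, v * v = 1 → ¬ Commute u v → ∀ H : Subgroup G,
      Subgroup.centralizer {u} ≤ H → Subgroup.centralizer {v} ≤ H → H = ⊤

section Matrices

open Matrix

variable {F : Type*} [Field F] [CharP F 2]

local notation "SL₂" => SpecialLinearGroup (Fin 2) F

/-- For the standard transvection u, the condition that u commutes with its conjugate by x says that
x is upper triangular; this passes from x to any a + bx. One base involution is enough, because all
involutions are later shown to be conjugate. -/
theorem sl_exists_base : ∃ u : SL₂, u ≠ 1 ∧ u * u = 1 ∧
    (∀ x y, x * x ≠ 1 → Commute u (x * u * x⁻¹) → Commute x y → Commute u (y * u * y⁻¹)) ∧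
    ∀ v, v * v = 1 → ¬ Commute u v → ∀ H : Subgroup SL₂,
      Subgroup.centralizer {u} ≤ H → Subgroup.centralizer {v} ≤ H → H = ⊤ := by
  let u : SL₂ := ⟨!![1, 1; 0, 1], by simp [Matrix.det_fin_two_of]⟩
  have u00 : u 0 0 = 1 := by simp [u]
  have u01 : u 0 1 = 1 := by simp [u]
  have u10 : u 1 0 = 0 := by simp [u]
  have u11 : u 1 1 = 1 := by simp [u]
  have hu : u ≠ 1 := by
    intro h
    have := congrArg (fun x : SL₂ ↦ x 0 1) h
    simp [u01] at this
  have hcomm (y : SL₂) : Commute u y ↔ y 1 0 = 0 ∧ y 0 0 = y 1 1 := by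
    rw [sl_commute_iff hu]
    simp only [u00, u01, u10, u11]
    constructor
    · rintro ⟨a, b, h1, h2, h3, h4⟩
      exact ⟨by rw [h3, mul_zero], by rw [h1, h4]⟩
    · rintro ⟨h1, h2⟩
      exact ⟨y 0 0 - y 0 1, y 0 1, by ring, by ring, by rw [h1]; ring, by rw [h2]; ring⟩
  have hnorm (x : SL₂) : Commute u (x * u * x⁻¹) ↔ x 1 0 = 0 := by
    obtain ⟨i1, i2, i3, i4⟩ := sl_inv x
    have hd := sl_det x
    rw [hcomm]
    simp only [sl_mul_apply, u00, u01, u10, u11, i1, i2, i3, i4]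
    constructor
    · rintro ⟨h1, -⟩
      have : x 1 0 * x 1 0 = 0 := by linear_combination -h1
      simpa using this
    · intro h
      rw [h]
      constructor <;> ring
  refine ⟨u, hu, (sl_sq_iff u).2 (by rw [u00, u11]), ?_, ?_⟩
  · intro x y hx hux hxy
    rw [hnorm] at hux ⊢
    obtain ⟨a, b, -, -, h3, -⟩ := (sl_commute_iff (ne_one_of_mul_self_ne hx) y).1 hxy
    rw [h3, hux, mul_zero]
  · intro v hv huv H hU hV
    rw [sl_sq_iff] at hv
    refine sl_upper_generate hv (fun h ↦ huv ((hcomm v).2 ⟨h, hv⟩)) (fun y h1 h2 h3 ↦ ?_) hV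
    exact hU (Subgroup.mem_centralizer_singleton_iff.2
      ((hcomm y).2 ⟨h1, by rw [h2, h3]⟩).symm)

theorem isEvenSL2_sl [Finite F] : IsEvenSL2 (Nat.card F) SL₂ where
  comm_trans _ _ _ := sl_comm_trans
  sq_of_comm _ _ := sl_sq_of_commute
  card_of_sq _ := sl_card_centralizer_of_sq
  isCyclic _ := sl_isCyclic_centralizer
  card_of_not_sq _ := sl_card_centralizer
  exists_inverting _ := sl_exists_inverting
  conj_eq _ _ := sl_conj_eq
  card_sq := sl_card_sq
  exists_base := sl_exists_base

end Matrices

theorem IsEvenSL2.congr {q : ℕ} {G G' : Type*} [Group G] [Group G'] (h : IsEvenSL2 q G)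
    (e : G' ≃* G) : IsEvenSL2 q G' := by
  have h1 (x : G') : x ≠ 1 ↔ e x ≠ 1 := by simp
  have hs (x : G') : x * x = 1 ↔ e x * e x = 1 := by
    rw [← map_mul]; exact (map_eq_one_iff e e.injective).symm
  have hc (x y : G') : Commute x y ↔ Commute (e x) (e y) := by
    simp only [Commute, SemiconjBy, ← map_mul, e.injective.eq_iff]
  let eC (x : G') : Subgroup.centralizer {x} ≃* Subgroup.centralizer {e x} :=
    (e.subgroupMap _).trans (MulEquiv.subgroupCongr (by
      ext y
      simp only [Subgroup.mem_map, Subgroup.mem_centralizer_singleton_iff]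
      constructor
      · rintro ⟨z, hz, rfl⟩
        change e z * e x = e x * e z
        rw [← map_mul, hz, map_mul]
      · intro hy
        refine ⟨e.symm y, ?_, by simp⟩
        apply e.injective
        simpa using hy))
  have hcard (x : G') : Nat.card (Subgroup.centralizer {x}) =
      Nat.card (Subgroup.centralizer {e x}) := Nat.card_congr (eC x).toEquiv
  constructor
  · intro x y z
    rw [h1, hc x y, hc x z, hc y z]
    exact h.comm_trans _ _ _
  · intro u y
    rw [h1, hs u, hc, hs y]
    exact h.sq_of_comm _ _
  · intro u
    rw [h1, hs, hcard]
    exact h.card_of_sq _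
  · intro x hx
    rw [Ne, hs] at hx
    exact (eC x).isCyclic.2 (h.isCyclic _ hx)
  · intro x
    rw [Ne, hs, hcard]
    exact h.card_of_not_sq _
  · intro x hx
    rw [Ne, hs] at hx
    obtain ⟨w, hw, hwx⟩ := h.exists_inverting _ hx
    refine ⟨e.symm w, by rw [hs]; simpa using hw, e.injective ?_⟩
    simpa using hwx
  · intro x g
    rw [Ne, hs, hc, ← e.injective.eq_iff, ← e.injective.eq_iff]
    simp only [map_mul, map_inv]
    exact h.conj_eq _ _
  · rw [← h.card_sq]
    exact Nat.card_congr (e.toEquiv.subtypeEquiv hs)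
  · obtain ⟨u, hu, hu2, hb, hgen⟩ := h.exists_base
    obtain ⟨u, rfl⟩ := e.surjective u
    refine ⟨u, (h1 u).2 hu, (hs u).2 hu2, ?_, ?_⟩
    · intro x y
      rw [Ne, hs, hc, hc x y, hc u (y * u * y⁻¹)]
      simp only [map_mul, map_inv]
      exact hb _ _
    · intro v hv huv H hU hV
      rw [hs] at hv
      rw [hc] at huv
      have hle (x : G') (hx : Subgroup.centralizer {x} ≤ H) :
          Subgroup.centralizer {e x} ≤ H.map e.toMonoidHom := by
        intro y hy
        refine ⟨e.symm y, hx (Subgroup.mem_centralizer_singleton_iff.2 (e.injective ?_)), by simp⟩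
        simpa using Subgroup.mem_centralizer_singleton_iff.1 hy
      have := hgen _ hv huv _ (hle u hU) (hle v hV)
      rw [eq_top_iff]
      intro y _
      obtain ⟨z, hz, hzy⟩ := this.symm ▸ Subgroup.mem_top (e y)
      rwa [← e.injective hzy]

theorem isEvenSL2_psl {F : Type*} [Field F] [CharP F 2] [Finite F] :
    IsEvenSL2 (Nat.card F) (Matrix.ProjectiveSpecialLinearGroup (Fin 2) F) := by
  have hcenter : Subgroup.center (Matrix.SpecialLinearGroup (Fin 2) F) = ⊥ := by
    rw [eq_bot_iff]
    intro x hx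
    rw [Subgroup.mem_bot]
    by_contra hne
    have h1 := Matrix.SpecialLinearGroup.mem_center_iff.1 hx
    obtain ⟨r, -, hr⟩ := h1
    have e (i j : Fin 2) : x i j = Matrix.scalar (Fin 2) r i j := by rw [hr]
    rcases sl_ne_one hne with h | h | h
    · exact h (by rw [e]; simp)
    · exact h (by rw [e]; simp)
    · exact h (by rw [e, e]; simp)
  exact isEvenSL2_sl.congr
    ((QuotientGroup.quotientMulEquivOfEq hcenter).trans QuotientGroup.quotientBot)

/-- The centralizer of an element. -/
abbrev cent {G : Type*} [Group G] (x : G) : Subgroup G := Subgroup.centralizer {x}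

/-- The normalizer of the centralizer of an element. -/
abbrev normCent {G : Type*} [Group G] (x : G) : Subgroup G := Subgroup.normalizer (cent x : Set G)

/-! ### Conjugation and orbit counting in an arbitrary group -/

section General

variable {G : Type*} [Group G]

theorem mem_cent {x y : G} : y ∈ cent x ↔ Commute x y :=
  Subgroup.mem_centralizer_singleton_iff.trans eq_comm

theorem cent_le_normCent (x : G) : cent x ≤ normCent x := Subgroup.le_normalizer

theorem commute_conj_iff {g x y : G} : Commute (g * x * g⁻¹) (g * y * g⁻¹) ↔ Commute x y := by
  simp [Commute, SemiconjBy]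

theorem conj_eq_one {g x : G} : g * x * g⁻¹ = 1 ↔ x = 1 := conj_eq_one_iff

theorem conj_mul_self {g x : G} : (g * x * g⁻¹) * (g * x * g⁻¹) = 1 ↔ x * x = 1 := by
  rw [← conj_eq_one (g := g) (x := x * x)]
  simp [mul_assoc]

/-- Orbit–stabilizer for K acting on the whole group by conjugation; u need not lie in K. -/
theorem ncard_conj_mul_card (K : Subgroup G) (u : G) :
    {v : G | ∃ g ∈ K, g * u * g⁻¹ = v}.ncard * Nat.card ↥(cent u ⊓ K) = Nat.card K := by
  let φ : K →* MulAut G := MulAut.conj.comp K.subtype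
  let _ : MulAction K G := MulAction.compHom G φ
  have hsmul (k : K) (x : G) : k • x = k * x * (k : G)⁻¹ := rfl
  have e1 : MulAction.orbit K u = {v : G | ∃ g ∈ K, g * u * g⁻¹ = v} := by
    ext v
    simp only [MulAction.mem_orbit_iff, hsmul, Subtype.exists, Set.mem_ofPred_eq, exists_prop]
  have e2 : Nat.card (MulAction.stabilizer K u) = Nat.card ↥(cent u ⊓ K) := by
    refine Nat.card_congr ⟨fun k ↦ ⟨k.1.1, ?_, k.1.2⟩, fun k ↦ ⟨⟨k.1, k.2.2⟩, ?_⟩,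
      fun _ ↦ rfl, fun _ ↦ rfl⟩
    · have := k.2
      rw [MulAction.mem_stabilizer_iff, hsmul, mul_inv_eq_iff_eq_mul] at this
      exact mem_cent.2 this.symm
    · rw [MulAction.mem_stabilizer_iff, hsmul, mul_inv_eq_iff_eq_mul]
      exact (mem_cent.1 k.2.1).eq.symm
  rw [← e1, ← e2, ← Nat.card_coe_set_eq, Nat.card_congr (MulAction.orbitEquivQuotientStabilizer K u)]
  exact (Subgroup.card_eq_card_quotient_mul_card_subgroup _).symm

end General

/-! ### Involutions: conjugacy, orders of their normalizers, generation -/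

namespace IsEvenSL2

variable {G : Type*} [Group G] {q : ℕ} (h : IsEvenSL2 q G)

include h

theorem commute_iff {x y : G} (hx : x ≠ 1) (hy : y ≠ 1) (hxy : Commute x y) (z : G) :
    Commute x z ↔ Commute y z :=
  ⟨h.comm_trans _ _ _ hx hxy, h.comm_trans _ _ _ hy hxy.symm⟩

theorem cent_eq {x y : G} (hx : x ≠ 1) (hy : y ≠ 1) (hxy : Commute x y) : cent x = cent y := by
  ext z
  rw [mem_cent, mem_cent, h.commute_iff hx hy hxy]

/-- Commuting non-identity elements have equal centralizers, so normalizing the centralizer can be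
tested on x alone. -/
theorem mem_normCent {x g : G} (hx : x ≠ 1) : g ∈ normCent x ↔ Commute x (g * x * g⁻¹) := by
  rw [Subgroup.mem_normalizer_iff]
  constructor
  · intro hg
    exact mem_cent.1 ((hg x).1 (mem_cent.2 (Commute.refl x)))
  · intro hg y
    rw [mem_cent, mem_cent, h.commute_iff hx (conj_eq_one.not.2 hx) hg (g * y * g⁻¹), commute_conj_iff]

theorem mul_self_ne_of_commute {x y : G} (hx : x * x ≠ 1) (hy : y ≠ 1) (hxy : Commute x y) :
    y * y ≠ 1 :=
  fun hyy ↦ hx (h.sq_of_comm y x hy hyy hxy.symm)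

theorem odd_card_cent (hq : Even q) (hq0 : q ≠ 0) {x : G} (hx : x * x ≠ 1) :
    Odd (Nat.card (cent x)) := by
  rcases h.card_of_not_sq x hx with e | e
  · rw [e]; exact Nat.Even.sub_odd (by omega) hq odd_one
  · rw [e]; exact hq.add_one

theorem odd_orderOf (hq : Even q) (hq0 : q ≠ 0) {x : G} (hx : x * x ≠ 1) : Odd (orderOf x) := by
  refine (h.odd_card_cent hq hq0 hx).of_dvd_nat ?_
  have : x ∈ cent x := mem_cent.2 (Commute.refl x)
  rw [← Subgroup.orderOf_mk x this]
  exact orderOf_dvd_natCard _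

/-- Non-commuting involutions are conjugate in the dihedral group that they generate. -/
theorem exists_conj_of_not_commute (hq : Even q) (hq0 : q ≠ 0) {u v : G} (hu : u * u = 1)
    (hv : v * v = 1) (huv : ¬ Commute u v) {H : Subgroup G} (huH : u ∈ H) (hvH : v ∈ H) :
    ∃ g ∈ H, g * u * g⁻¹ = v := by
  have hu' : u⁻¹ = u := inv_eq_of_mul_eq_one_left hu
  have hv' : v⁻¹ = v := inv_eq_of_mul_eq_one_left hv
  set z := v * u with hz
  have hzz : z * z ≠ 1 := by
    intro hzz
    apply huv
    have := inv_eq_of_mul_eq_one_left hzz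
    rw [hz, mul_inv_rev, hu', hv'] at this
    exact this
  obtain ⟨k, hk⟩ := h.odd_orderOf hq hq0 hzz
  have hs : SemiconjBy u z z⁻¹ := by
    rw [SemiconjBy, hz, mul_inv_rev, hu', hv', mul_assoc]
  have hs' : SemiconjBy u (z ^ (k + 1)) ((z ^ (k + 1))⁻¹) := by
    rw [← inv_pow]; exact hs.pow_right _
  -- The order of z = vu is 2k + 1, so z ^ (k + 1) is a square root of z. As u inverts z,
  -- conjugating u by this root gives zu = v.
  refine ⟨z ^ (k + 1), H.pow_mem (H.mul_mem hvH huH) _, ?_⟩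
  have e1 : u * (z ^ (k + 1))⁻¹ = z ^ (k + 1) * u := by
    have := hs'.inv_right
    rw [inv_inv] at this
    exact this.eq
  have e2 : z ^ (k + 1) * z ^ (k + 1) = z := by
    rw [← pow_add, show k + 1 + (k + 1) = orderOf z + 1 by omega, pow_succ, pow_orderOf_eq_one,
      one_mul]
  rw [mul_assoc, e1, ← mul_assoc, e2, hz, mul_assoc, hu, mul_one]

/-- If a subgroup has two non-commuting involutions, then all its involutions are conjugate. -/
theorem exists_conj_of_mem (hq : Even q) (hq0 : q ≠ 0) {H : Subgroup G} {u v w : G}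
    (hu : u * u = 1) (hv : v * v = 1) (huv : ¬ Commute u v) (huH : u ∈ H) (hvH : v ∈ H)
    (hw : w * w = 1) (hw1 : w ≠ 1) (hwH : w ∈ H) : ∃ g ∈ H, g * u * g⁻¹ = w := by
  by_cases huw : Commute u w
  · have hvw : ¬ Commute v w := fun hvw ↦ huv (h.comm_trans w u v hw1 huw.symm hvw.symm)
    obtain ⟨a, ha, rfl⟩ := h.exists_conj_of_not_commute hq hq0 hu hv huv huH hvH
    obtain ⟨b, hb, rfl⟩ := h.exists_conj_of_not_commute hq hq0 hv hw hvw hvH hwH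
    exact ⟨b * a, H.mul_mem hb ha, by group⟩
  · exact h.exists_conj_of_not_commute hq hq0 hu hw huw huH hwH

theorem ncard_involutions_mul (hq : Even q) (hq0 : q ≠ 0) {H : Subgroup G} {u v : G}
    (hu : u * u = 1) (hv : v * v = 1) (huv : ¬ Commute u v) (huH : u ∈ H) (hvH : v ∈ H) :
    {w : G | w ≠ 1 ∧ w * w = 1 ∧ w ∈ H}.ncard * Nat.card ↥(cent u ⊓ H) = Nat.card H := by
  have hu1 : u ≠ 1 := by rintro rfl; exact huv (Commute.one_left v)
  rw [← ncard_conj_mul_card H u]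
  congr 2
  ext w
  constructor
  · rintro ⟨h1, h2, h3⟩
    exact h.exists_conj_of_mem hq hq0 hu hv huv huH hvH h2 h1 h3
  · rintro ⟨g, hg, rfl⟩
    exact ⟨conj_eq_one.not.2 hu1, conj_mul_self.2 hu, H.mul_mem (H.mul_mem hg huH) (H.inv_mem hg)⟩

/-- The involutions of H are conjugate in H, and an element carrying u to something commuting with u
normalizes the centralizer of u. So the normalizer in H acts transitively on the non-identity
elements of C_H(u), with stabilizer C_H(u). -/
theorem card_normCent_inf [Finite G] (hq : Even q) (hq0 : q ≠ 0) {H : Subgroup G} {u v : G}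
    (hu : u * u = 1) (hv : v * v = 1) (huv : ¬ Commute u v) (huH : u ∈ H) (hvH : v ∈ H) :
    (Nat.card ↥(cent u ⊓ H) - 1) * Nat.card ↥(cent u ⊓ H) = Nat.card ↥(normCent u ⊓ H) := by
  have hu1 : u ≠ 1 := by rintro rfl; exact huv (Commute.one_left v)
  rw [← ncard_conj_mul_card (normCent u ⊓ H) u]
  have e1 : cent u ⊓ (normCent u ⊓ H) = cent u ⊓ H := by
    rw [← inf_assoc, inf_eq_left.2 (cent_le_normCent u)]
  have e2 : {v : G | ∃ g ∈ normCent u ⊓ H, g * u * g⁻¹ = v} = ((cent u ⊓ H : Subgroup G) : Set G) \ {1} := by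
    ext w
    simp only [Set.mem_ofPred_eq, Set.mem_sdiff, SetLike.mem_coe, Set.mem_singleton_iff,
      Subgroup.mem_inf, mem_cent]
    constructor
    · rintro ⟨g, ⟨hg, hgH⟩, rfl⟩
      exact ⟨⟨(h.mem_normCent hu1).1 hg, H.mul_mem (H.mul_mem hgH huH) (H.inv_mem hgH)⟩,
        conj_eq_one.not.2 hu1⟩
    · rintro ⟨⟨huw, hwH⟩, hw⟩
      obtain ⟨g, hg, rfl⟩ := h.exists_conj_of_mem hq hq0 hu hv huv huH hvH
        (h.sq_of_comm u w hu1 hu huw) hw hwH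
      exact ⟨g, ⟨(h.mem_normCent hu1).2 huw, hg⟩, rfl⟩
  rw [e1, e2, Set.ncard_sdiff_singleton_of_mem (Subgroup.one_mem _)]
  rfl

theorem exists_not_commute [Finite G] (hq2 : 2 ≤ q) {u : G} (hu1 : u ≠ 1) (hu : u * u = 1) :
    ∃ v, v * v = 1 ∧ ¬ Commute u v := by
  by_contra! hc
  have hle : Nat.card {u : G // u * u = 1} ≤ Nat.card (cent u) :=
    Nat.card_le_card_of_injective (fun v ↦ (⟨v.1, mem_cent.2 (hc v.1 v.2)⟩ : cent u))
      (fun a b hab ↦ Subtype.ext (by simpa using hab))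
  rw [h.card_sq, h.card_of_sq u hu1 hu] at hle
  nlinarith

theorem ncard_involutions : {w : G | w ≠ 1 ∧ w * w = 1}.ncard = q ^ 2 - 1 := by
  have : {w : G | w ≠ 1 ∧ w * w = 1} = {w : G | w * w = 1} \ {1} := by
    ext w; simp [and_comm]
  rw [this, Set.ncard_sdiff_singleton_of_mem (by simp)]
  congr 1
  exact h.card_sq

/-- The q² - 1 involutions form a single class with centralizers of order q. -/
theorem card_eq [Finite G] (hq : Even q) (hq2 : 2 ≤ q) : Nat.card G = (q ^ 2 - 1) * q := by
  obtain ⟨u, hu1, hu, -⟩ := h.exists_base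
  obtain ⟨v, hv, huv⟩ := h.exists_not_commute hq2 hu1 hu
  have := h.ncard_involutions_mul hq (by omega) hu hv huv (Subgroup.mem_top u) (Subgroup.mem_top v)
  simpa [h.ncard_involutions, h.card_of_sq u hu1 hu] using this.symm

theorem isConj_of_involutions [Finite G] (hq : Even q) (hq2 : 2 ≤ q) {u v : G} (hu1 : u ≠ 1)
    (hu : u * u = 1) (hv1 : v ≠ 1) (hv : v * v = 1) : ∃ g, g * u * g⁻¹ = v := by
  obtain ⟨w, hw, huw⟩ := h.exists_not_commute hq2 hu1 hu
  obtain ⟨g, -, hg⟩ := h.exists_conj_of_mem hq (by omega) hu hw huw (Subgroup.mem_top u)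
    (Subgroup.mem_top w) hv hv1 (Subgroup.mem_top v)
  exact ⟨g, hg⟩

theorem card_normCent_of_sq [Finite G] (hq : Even q) (hq2 : 2 ≤ q) {u : G} (hu1 : u ≠ 1)
    (hu : u * u = 1) : Nat.card (normCent u) = (q - 1) * q := by
  obtain ⟨v, hv, huv⟩ := h.exists_not_commute hq2 hu1 hu
  have := h.card_normCent_inf hq (by omega) hu hv huv (Subgroup.mem_top u) (Subgroup.mem_top v)
  rwa [inf_top_eq, inf_top_eq, h.card_of_sq u hu1 hu, eq_comm] at this

/-- A Borel subgroup containing x with x² ≠ 1 contains the whole torus of x. The property is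
transported from the base involution by conjugation. -/
theorem cent_le_normCent_of_sq [Finite G] (hq : Even q) (hq2 : 2 ≤ q) {u x y : G} (hu1 : u ≠ 1)
    (hu : u * u = 1) (hx : x * x ≠ 1) (hxu : x ∈ normCent u) (hxy : Commute x y) :
    y ∈ normCent u := by
  obtain ⟨v, hv1, hv, hb, -⟩ := h.exists_base
  obtain ⟨g, rfl⟩ := h.isConj_of_involutions hq hq2 hv1 hv hu1 hu
  rw [h.mem_normCent hu1] at hxu ⊢
  have key := hb (g⁻¹ * x * g) (g⁻¹ * y * g) ?_ ?_ ?_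
  · rw [← commute_conj_iff (g := g)] at key
    convert key using 1
    group
  · have := conj_mul_self (g := g⁻¹) (x := x)
    rw [inv_inv] at this
    rwa [Ne, this]
  · rw [← commute_conj_iff (g := g)]
    convert hxu using 1
    group
  · rw [← commute_conj_iff (g := g)]
    convert hxy using 1 <;> group

theorem eq_top_of_cent_le [Finite G] (hq : Even q) (hq2 : 2 ≤ q) {u v : G} (hu : u * u = 1)
    (hv : v * v = 1) (huv : ¬ Commute u v) {H : Subgroup G} (hU : cent u ≤ H) (hV : cent v ≤ H) :
    H = ⊤ := by
  have hu1 : u ≠ 1 := by rintro rfl; exact huv (Commute.one_left v)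
  obtain ⟨w, hw1, hw, -, hgen⟩ := h.exists_base
  obtain ⟨g, rfl⟩ := h.isConj_of_involutions hq hq2 hw1 hw hu1 hu
  have hle (x : G) (hx : cent x ≤ H) :
      cent (g⁻¹ * x * g) ≤ H.comap (MulAut.conj g).toMonoidHom := by
    intro y hy
    refine hx (mem_cent.2 ?_)
    change Commute x (g * y * g⁻¹)
    have := commute_conj_iff (g := g) |>.2 (mem_cent.1 hy)
    convert this using 1
    group
  have key := hgen (g⁻¹ * v * g) (by
    have := conj_mul_self (g := g⁻¹) (x := v)
    rw [inv_inv] at this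
    rwa [this]) (by
      rw [← commute_conj_iff (g := g)]
      convert huv using 2
      group) (H.comap (MulAut.conj g).toMonoidHom) (by
        have := hle _ hU
        convert this using 2
        group) (hle v hV)
  rw [eq_top_iff]
  intro y _
  have : g⁻¹ * y * g ∈ H.comap (MulAut.conj g).toMonoidHom := key ▸ Subgroup.mem_top _
  change g * (g⁻¹ * y * g) * g⁻¹ ∈ H at this
  convert this using 1
  group

end IsEvenSL2
-- Torus normalizers and the classification of proper subgroups
theorem ncard_biUnion_const {α ι : Type*} [Finite α] [Finite ι] {t : Set ι} {s : ι → Set α} {m : ℕ}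
    (hd : t.PairwiseDisjoint s) (hm : ∀ i ∈ t, (s i).ncard = m) :
    (⋃ i ∈ t, s i).ncard = t.ncard * m := by
  rw [t.toFinite.ncard_biUnion (fun i _ ↦ (s i).toFinite) hd, finsum_mem_congr rfl hm,
    finsum_mem_eq_finite_toFinset_sum _ t.toFinite, Finset.sum_const, smul_eq_mul,
    ← Set.ncard_eq_toFinset_card t]

theorem not_commute_of_inverts {G : Type*} [Group G] {x w : G} (hx : x * x ≠ 1) (hw : w * x * w⁻¹ = x⁻¹) :
    ¬ Commute x w := by
  intro hc
  rw [← hc.eq, mul_assoc, mul_inv_cancel, mul_one] at hw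
  exact hx (mul_eq_one_iff_eq_inv.2 hw)

namespace IsEvenSL2

variable {G : Type*} [Group G] {q : ℕ} (h : IsEvenSL2 q G)

include h

theorem mem_normCent_of_inverts {x w : G} (hx : x * x ≠ 1) (hw : w * x * w⁻¹ = x⁻¹) :
    w ∈ normCent x := by
  rw [h.mem_normCent (ne_one_of_mul_self_ne hx), hw]
  exact (Commute.refl x).inv_right

theorem mem_normCent_iff {x g : G} (hx : x * x ≠ 1) :
    g ∈ normCent x ↔ Commute x g ∨ g * x * g⁻¹ = x⁻¹ := by
  constructor
  · intro hg
    rw [h.mem_normCent (ne_one_of_mul_self_ne hx)] at hg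
    refine (h.conj_eq x g hx hg).imp_left fun e ↦ ?_
    rw [mul_inv_eq_iff_eq_mul] at e
    exact e.symm
  · rintro (hg | hg)
    · exact cent_le_normCent x (mem_cent.2 hg)
    · exact h.mem_normCent_of_inverts hx hg

/-- Conjugation by w sends a generator r of the torus to r or r⁻¹. The first would make w centralize
the torus and hence x, so w inverts every power of r. -/
theorem inverts_of_commute {x w c : G} (hx : x * x ≠ 1) (hw : w * x * w⁻¹ = x⁻¹)
    (hc : Commute x c) : w * c * w⁻¹ = c⁻¹ := by
  have hx1 := ne_one_of_mul_self_ne hx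
  obtain ⟨⟨r, hr⟩, hgen⟩ := h.isCyclic x hx
  have hgen' (y : G) (hy : Commute x y) : ∃ n : ℤ, r ^ n = y := by
    obtain ⟨n, hn⟩ := hgen ⟨y, mem_cent.2 hy⟩
    exact ⟨n, congrArg Subtype.val hn⟩
  have hxr : Commute x r := mem_cent.1 hr
  have hr1 : r ≠ 1 := by
    rintro rfl
    obtain ⟨n, hn⟩ := hgen' x (Commute.refl x)
    exact hx1 (by rw [← hn, one_zpow])
  have hrr := h.mul_self_ne_of_commute hx hr1 hxr
  have hwr : Commute r (w * r * w⁻¹) := by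
    have := (Subgroup.mem_normalizer_iff.1 (h.mem_normCent_of_inverts hx hw) r).1 hr
    exact h.comm_trans x _ _ hx1 hxr (mem_cent.1 this)
  have hinv : w * r * w⁻¹ = r⁻¹ := by
    refine (h.conj_eq r w hrr hwr).resolve_left fun e ↦ ?_
    rw [mul_inv_eq_iff_eq_mul] at e
    exact not_commute_of_inverts hx hw ((h.commute_iff hx1 hr1 hxr w).2 e.symm)
  obtain ⟨n, rfl⟩ := hgen' c hc
  rw [← conj_zpow, hinv, inv_zpow]

/-- Let w be an involution inverting x. Then wg centralizes x, so g inverts wg; cancelling w from gw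
= g⁻¹w gives g = g⁻¹. -/
theorem mul_self_of_inverts {x g : G} (hx : x * x ≠ 1) (hg : g * x * g⁻¹ = x⁻¹) : g * g = 1 := by
  obtain ⟨w, hw, hwx⟩ := h.exists_inverting x hx
  have hw' : w⁻¹ = w := inv_eq_of_mul_eq_one_left hw
  have hc : Commute x (w * g) := by
    have : (w * g) * x * (w * g)⁻¹ = x := by
      calc (w * g) * x * (w * g)⁻¹ = w * (g * x * g⁻¹) * w⁻¹ := by group
        _ = (w * x * w⁻¹)⁻¹ := by rw [hg]; group
        _ = x := by rw [hwx, inv_inv]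
    rw [mul_inv_eq_iff_eq_mul] at this
    exact this.symm
  have key := h.inverts_of_commute hx hg hc
  have : g = g⁻¹ := by
    apply mul_right_cancel (b := w)
    simpa [hw', mul_assoc] using key
  exact mul_eq_one_iff_eq_inv.2 this

/-- Let c = |C_H(x)| and let T(x) be the set of H-conjugates of the non-identity elements of C_H(x).
Distinct elements of C_H(x) are not H-conjugate, so |T(x)| = (c - 1)|H|/c ≥ |H|/2. The sets T(x) and
T(z) are disjoint when z ∉ T(x), and two of them do not fit into H \ {1}. So T(x) = H \ {1}, and the
count then gives c = |H|. -/
theorem le_cent_of_odd [Finite G] {H : Subgroup G} (hH : ∀ y ∈ H, y * y = 1 → y = 1) {x : G} (hx : x ∈ H)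
    (hx1 : x ≠ 1) : H ≤ cent x := by
  set T : G → Set G := fun x ↦ ⋃ y ∈ ((cent x ⊓ H : Subgroup G) : Set G) \ {1},
    {v | ∃ g ∈ H, g * y * g⁻¹ = v} with hT
  have hsq {x : G} (hx : x ∈ H) (hx1 : x ≠ 1) : x * x ≠ 1 := fun hxx ↦ hx1 (hH x hx hxx)
  have hconj {x y z g : G} (hx : x ∈ H) (hx1 : x ≠ 1) (hxy : Commute x y)
      (hg : g ∈ H) (hgxy : g * x * g⁻¹ = y) : g * x * g⁻¹ = x := by
    -- An element of H inverting x has square 1, so it is 1 by hypothesis, and 1 does not invert x.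
    refine (h.conj_eq x g (hsq hx hx1) (by rwa [hgxy])).resolve_right fun e ↦ ?_
    have := hH g hg (h.mul_self_of_inverts (hsq hx hx1) e)
    subst this
    exact not_commute_of_inverts (hsq hx hx1) e (Commute.one_right x)
  have hcard {x : G} (hx : x ∈ H) (hx1 : x ≠ 1) : (T x).ncard * Nat.card ↥(cent x ⊓ H) =
      (Nat.card ↥(cent x ⊓ H) - 1) * Nat.card H := by
    have h1 : (T x).ncard = (((cent x ⊓ H : Subgroup G) : Set G) \ {1}).ncard *
        (Nat.card H / Nat.card ↥(cent x ⊓ H)) := by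
      apply ncard_biUnion_const
      · rintro y ⟨⟨hy, hyH⟩, hy1⟩ z ⟨⟨hz, hzH⟩, hz1⟩ hyz
        rw [Function.onFun, Set.disjoint_left]
        rintro v ⟨a, ha, rfl⟩ ⟨b, hb, hab⟩
        apply hyz
        have hyz : Commute y z := h.comm_trans x y z hx1 (mem_cent.1 hy) (mem_cent.1 hz)
        have e : (b⁻¹ * a) * y * (b⁻¹ * a)⁻¹ = z := by
          calc (b⁻¹ * a) * y * (b⁻¹ * a)⁻¹ = b⁻¹ * (a * y * a⁻¹) * b := by group
            _ = z := by rw [← hab]; group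
        rw [← hconj hyH hy1 hyz (H.mul_mem (H.inv_mem hb) ha) e (z := z), e]
      · rintro y ⟨⟨hy, hyH⟩, hy1⟩
        have := ncard_conj_mul_card H y
        rw [← h.cent_eq hx1 hy1 (mem_cent.1 hy)] at this
        exact Nat.eq_div_of_mul_eq_left Nat.card_pos.ne' this
    rw [h1, Set.ncard_sdiff_singleton_of_mem (Subgroup.one_mem _), mul_assoc,
      Nat.div_mul_cancel (Subgroup.card_dvd_of_le inf_le_right)]
    rfl
  have hsub {x : G} : T x ⊆ (H : Set G) \ {1} := by
    intro v hv
    simp only [hT, Set.mem_iUnion] at hv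
    obtain ⟨y, ⟨⟨-, hy⟩, hy1⟩, g, hg, rfl⟩ := hv
    exact ⟨H.mul_mem (H.mul_mem hg hy) (H.inv_mem hg), conj_eq_one.not.2 hy1⟩
  have htwo {x : G} (hx : x ∈ H) (hx1 : x ≠ 1) : 2 ≤ Nat.card ↥(cent x ⊓ H) := by
    have : Nontrivial ↥(cent x ⊓ H) :=
      ⟨⟨⟨x, mem_cent.2 (Commute.refl x), hx⟩, 1, fun e ↦ hx1 (congrArg Subtype.val e)⟩⟩
    exact Finite.one_lt_card
  have hH1 : ((H : Set G) \ {1}).ncard = Nat.card H - 1 := by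
    rw [Set.ncard_sdiff_singleton_of_mem H.one_mem]
    rfl
  have hHpos : 0 < Nat.card H := Nat.card_pos
  have hfull : T x = (H : Set G) \ {1} := by
    refine hsub.antisymm ?_
    rintro z ⟨hz, hz1⟩
    by_contra hzT
    have hdisj : Disjoint (T x) (T z) := by
      rw [Set.disjoint_left]
      intro v hv hv'
      simp only [hT, Set.mem_iUnion] at hv hv'
      obtain ⟨a, ⟨⟨hxa, haH⟩, ha1⟩, g, hg, rfl⟩ := hv
      obtain ⟨b, ⟨⟨hzb, hbH⟩, hb1⟩, k, hk, hab⟩ := hv'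
      apply hzT
      have hg' : ∀ y, g⁻¹ * k * y * (g⁻¹ * k)⁻¹ = g⁻¹ * (k * y * k⁻¹) * g := fun y ↦ by group
      have h1 : Commute a (g⁻¹ * k * z * (g⁻¹ * k)⁻¹) := by
        have e : a = g⁻¹ * k * b * (g⁻¹ * k)⁻¹ := by
          rw [hg', hab]; group
        rw [e, commute_conj_iff]
        exact (mem_cent.1 hzb).symm
      have hz' := conj_eq_one (g := g⁻¹ * k) |>.not.2 hz1
      have h2 : Commute x (g⁻¹ * k * z * (g⁻¹ * k)⁻¹) :=
        h.comm_trans a _ _ ha1 (mem_cent.1 hxa).symm h1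
      have hm : g⁻¹ * k ∈ H := H.mul_mem (H.inv_mem hg) hk
      simp only [hT, Set.mem_iUnion]
      exact ⟨_, ⟨⟨mem_cent.2 h2, H.mul_mem (H.mul_mem hm hz) (H.inv_mem hm)⟩, hz'⟩,
        (g⁻¹ * k)⁻¹, H.inv_mem hm, by group⟩
    have hle := Set.ncard_le_ncard (Set.union_subset (hsub (x := x)) (hsub (x := z)))
    rw [Set.ncard_union_eq hdisj, hH1] at hle
    have key {x : G} (hx : x ∈ H) (hx1 : x ≠ 1) : Nat.card H ≤ 2 * (T x).ncard := by
      have h1 := hcard hx hx1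
      have h2 := htwo hx hx1
      obtain ⟨a, ha⟩ : ∃ a, Nat.card ↥(cent x ⊓ H) = a + 2 := ⟨_, (Nat.sub_add_cancel h2).symm⟩
      rw [ha] at h1
      simp only [Nat.add_succ_sub_one] at h1
      by_contra! hlt
      nlinarith
    have := key hx hx1
    have := key hz hz1
    omega
  have h1 := hcard hx hx1
  rw [hfull, hH1] at h1
  have h2 := htwo hx hx1
  have hle : Nat.card H ≤ Nat.card ↥(cent x ⊓ H) := by
    obtain ⟨a, ha⟩ : ∃ a, Nat.card ↥(cent x ⊓ H) = a + 1 := ⟨_, (Nat.sub_add_cancel (by omega)).symm⟩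
    obtain ⟨b, hb⟩ : ∃ b, Nat.card H = b + 1 := ⟨_, (Nat.sub_add_cancel (by omega)).symm⟩
    rw [ha, hb] at h1 ⊢
    simp only [Nat.add_sub_cancel] at h1
    nlinarith
  have := Subgroup.eq_of_le_of_card_ge (inf_le_right : cent x ⊓ H ≤ H) hle
  exact inf_eq_right.1 this

/-- The order is 2 ^ k, and (2 ^ k - 1) 2 ^ k divides (q - 1)q by `card_normCent_inf`. Hence 2 ^ k -
1 divides 2 ^ p - 1, and k divides p. Primality of the exponent matters here: it rules out subgroups
over proper intermediate subfields. -/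
theorem card_cent_inf_eq [Finite G] {p : ℕ} (hp : p.Prime) (hq : q = 2 ^ p) {H : Subgroup G}
    {u v : G} (hu : u * u = 1) (hv : v * v = 1) (huv : ¬ Commute u v) (huH : u ∈ H) (hvH : v ∈ H) :
    Nat.card ↥(cent u ⊓ H) = 2 ∨ Nat.card ↥(cent u ⊓ H) = q := by
  have hu1 : u ≠ 1 := by rintro rfl; exact huv (Commute.one_left v)
  have hqe : Even q := by rw [hq]; exact (Nat.even_pow.2 ⟨even_two, hp.ne_zero⟩)
  have hq2 : 2 ≤ q := by rw [hq]; exact Nat.le_self_pow hp.ne_zero 2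
  have hdvd : Nat.card ↥(cent u ⊓ H) ∣ q := by
    rw [← h.card_of_sq u hu1 hu]; exact Subgroup.card_dvd_of_le inf_le_left
  obtain ⟨k, hkp, hk⟩ := (Nat.dvd_prime_pow Nat.prime_two).1 (hq ▸ hdvd)
  have h1 := h.card_normCent_inf hqe (by omega) hu hv huv huH hvH
  have h2 : Nat.card ↥(normCent u ⊓ H) ∣ (q - 1) * q := by
    rw [← h.card_normCent_of_sq hqe hq2 hu1 hu]; exact Subgroup.card_dvd_of_le inf_le_left
  rw [← h1, hk] at h2
  have hk0 : k ≠ 0 := by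
    rintro rfl
    rw [pow_zero, Subgroup.card_eq_one] at hk
    exact hu1 (Subgroup.mem_bot.1 (hk ▸ ⟨mem_cent.2 (Commute.refl u), huH⟩))
  have hodd : Nat.Coprime (2 ^ k - 1) q := by
    rw [hq]
    apply Nat.Coprime.pow_right
    rw [Nat.coprime_two_right]
    exact Nat.Even.sub_odd Nat.one_le_two_pow (Nat.even_pow.2 ⟨even_two, hk0⟩) odd_one
  have h3 : 2 ^ k - 1 ∣ 2 ^ p - 1 := by
    rw [← hq]
    exact hodd.dvd_of_dvd_mul_right ((Dvd.intro _ rfl).trans h2)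
  have h4 := Nat.gcd_eq_left h3
  rw [Nat.pow_sub_one_gcd_pow_sub_one] at h4
  have h5 : Nat.gcd k p = k := by
    apply Nat.pow_right_injective le_rfl
    have a1 : 1 ≤ 2 ^ k := Nat.one_le_two_pow
    have a2 : 1 ≤ 2 ^ Nat.gcd k p := Nat.one_le_two_pow
    change 2 ^ Nat.gcd k p = 2 ^ k
    omega
  rcases (Nat.dvd_prime hp).1 (h5 ▸ Nat.gcd_dvd_right k p) with rfl | rfl
  · left; rw [hk, pow_one]
  · right; rw [hk, hq]

/-- If the involution centralizers in `H` have order two, then the involutions of `H` generate a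
dihedral group, and every element of `H` is an involution or a product of two of them. -/
theorem le_normCent_of_card_eq_two [Finite G] (hq : Even q) (hq0 : q ≠ 0) {H : Subgroup G}
    {u v : G} (hu : u * u = 1) (hv : v * v = 1) (huv : ¬ Commute u v) (huH : u ∈ H) (hvH : v ∈ H)
    (h2 : Nat.card ↥(cent u ⊓ H) = 2) : H ≤ normCent (u * v) := by
  set I : Set G := {w : G | w ≠ 1 ∧ w * w = 1 ∧ w ∈ H} with hI
  have hIcard : I.ncard * 2 = Nat.card H := by
    rw [← h2]; exact h.ncard_involutions_mul hq hq0 hu hv huv huH hvH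
  have hinv {w : G} (hw : w * w = 1) : w⁻¹ = w := inv_eq_of_mul_eq_one_left hw
  have hu1 : u ≠ 1 := by rintro rfl; exact huv (Commute.one_left v)
  have hv1 : v ≠ 1 := by rintro rfl; exact huv (Commute.one_right u)
  -- If wi were an involution, w and i would commute, and i would lie in C_H(w) = {1, w}. So wI
  -- misses I, and both have |H|/2 elements.
  have hImage {w : G} (hw : w ∈ I) : (fun i ↦ w * i) '' I = (H : Set G) \ I := by
    obtain ⟨hw1, hww, hwH⟩ := hw
    have hwcard : Nat.card ↥(cent w ⊓ H) = 2 := by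
      obtain ⟨t, htt, htw, htH⟩ : ∃ t, t * t = 1 ∧ ¬ Commute w t ∧ t ∈ H := by
        by_cases hwu : Commute w u
        · exact ⟨v, hv, fun hwv ↦ huv (h.comm_trans w u v hw1 hwu hwv), hvH⟩
        · exact ⟨u, hu, hwu, huH⟩
      have := h.ncard_involutions_mul hq hq0 hww htt htw hwH htH
      rw [← hIcard] at this
      have hpos : 0 < I.ncard := by rw [Set.ncard_pos]; exact ⟨u, hu1, hu, huH⟩
      exact Nat.eq_of_mul_eq_mul_left hpos this
    have hpair : ((cent w ⊓ H : Subgroup G) : Set G) = {1, w} := by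
      symm
      refine Set.eq_of_subset_of_ncard_le ?_ ?_ (Set.toFinite _)
      · rintro y (rfl | rfl)
        · exact Subgroup.one_mem _
        · exact ⟨mem_cent.2 (Commute.refl _), hwH⟩
      · rw [Set.ncard_pair hw1.symm]
        exact hwcard.le
    refine Set.eq_of_subset_of_ncard_le ?_ ?_ (Set.toFinite _)
    · rintro _ ⟨i, ⟨hi1, hii, hiH⟩, rfl⟩
      refine ⟨H.mul_mem hwH hiH, ?_⟩
      rintro ⟨hwi1, hwi, -⟩
      have hc : Commute w i := by
        have := hinv hwi
        rw [mul_inv_rev, hinv hii, hinv hww] at this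
        exact this.symm
      have : i ∈ ({1, w} : Set G) := hpair ▸ (⟨mem_cent.2 hc, hiH⟩ : i ∈ cent w ⊓ H)
      rcases this with rfl | rfl
      · exact hi1 rfl
      · exact hwi1 hww
    · rw [Set.ncard_image_of_injective _ (mul_right_injective w),
        Set.ncard_sdiff (fun y hy ↦ hy.2.2)]
      have : (H : Set G).ncard = Nat.card H := rfl
      omega
  have huI : u ∈ I := ⟨hu1, hu, huH⟩
  have hxx : (u * v) * (u * v) ≠ 1 := by
    intro hc
    have := hinv hc
    rw [mul_inv_rev, hinv hu, hinv hv] at this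
    exact huv this.symm
  have hInv : ∀ w ∈ I, w ∈ normCent (u * v) := by
    intro w hw
    apply h.mem_normCent_of_inverts hxx
    -- Since uv lies in wI, it is a product of w and another involution, hence is inverted by w.
    have : u * v ∈ (H : Set G) \ I := ⟨H.mul_mem huH hvH, fun hc ↦ hxx hc.2.1⟩
    rw [← hImage hw] at this
    obtain ⟨i, ⟨-, hii, -⟩, hi⟩ := this
    rw [← hi, mul_inv_rev, hinv hw.2.1, hinv hii, ← mul_assoc, hw.2.1, one_mul]
  intro y hy
  by_cases hyI : y ∈ I
  · exact hInv y hyI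
  · have : y ∈ (fun i ↦ u * i) '' I := hImage huI ▸ ⟨hy, hyI⟩
    obtain ⟨i, hi, rfl⟩ := this
    exact Subgroup.mul_mem _ (hInv u huI) (hInv i hi)

/-- Every proper subgroup normalizes the centralizer of a non-trivial element. -/
theorem exists_le_normCent [Finite G] {p : ℕ} (hp : p.Prime) (hq : q = 2 ^ p) {H : Subgroup G}
    (hH : H ≠ ⊤) : ∃ x, x ≠ 1 ∧ H ≤ normCent x := by
  have hqe : Even q := by rw [hq]; exact (Nat.even_pow.2 ⟨even_two, hp.ne_zero⟩)
  have hq2 : 2 ≤ q := by rw [hq]; exact Nat.le_self_pow hp.ne_zero 2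
  by_cases hnc : ∃ u ∈ H, ∃ v ∈ H, u * u = 1 ∧ v * v = 1 ∧ ¬ Commute u v
  · obtain ⟨u, huH, v, hvH, hu, hv, huv⟩ := hnc
    have hu1 : u ≠ 1 := by rintro rfl; exact huv (Commute.one_left v)
    rcases h.card_cent_inf_eq hp hq hu hv huv huH hvH with h2 | h2
    · exact ⟨u * v, fun hc ↦ huv (by rw [eq_inv_of_mul_eq_one_left hc]; exact (Commute.refl v).inv_left),
        h.le_normCent_of_card_eq_two hqe (by omega) hu hv huv huH hvH h2⟩
    · exfalso
      apply hH
      have hU : cent u ≤ H := inf_eq_left.1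
        (Subgroup.eq_of_le_of_card_ge inf_le_left (by rw [h2, h.card_of_sq u hu1 hu]))
      -- The centralizer of v is the conjugate of that of u by an element of H, so both lie in H,
      -- and together they generate G.
      refine h.eq_top_of_cent_le hqe hq2 hu hv huv hU fun y hy ↦ ?_
      obtain ⟨g, hg, rfl⟩ := h.exists_conj_of_not_commute hqe (by omega) hu hv huv huH hvH
      have : g⁻¹ * y * g ∈ H := hU (mem_cent.2 (by
        rw [← commute_conj_iff (g := g)]
        convert mem_cent.1 hy using 1
        group))
      have := H.mul_mem (H.mul_mem hg this) (H.inv_mem hg)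
      convert this using 1
      group
  · push Not at hnc
    by_cases hinv : ∃ u ∈ H, u ≠ 1 ∧ u * u = 1
    · obtain ⟨u, huH, hu1, hu⟩ := hinv
      exact ⟨u, hu1, fun g hg ↦ (h.mem_normCent hu1).2 (hnc u huH _
        (H.mul_mem (H.mul_mem hg huH) (H.inv_mem hg)) hu (conj_mul_self.2 hu))⟩
    · push Not at hinv
      by_cases hbot : H = ⊥
      · obtain ⟨u, hu1, -⟩ := h.exists_base
        exact ⟨u, hu1, hbot ▸ bot_le⟩
      · obtain ⟨⟨x, hx⟩, hx1⟩ := Subgroup.ne_bot_iff_exists_ne_one.1 hbot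
        replace hx1 : x ≠ 1 := fun e ↦ hx1 (Subtype.ext e)
        refine ⟨x, hx1, (h.le_cent_of_odd (fun y hy hyy ↦ ?_) hx hx1).trans (cent_le_normCent _)⟩
        by_contra hy1
        exact hinv y hy hy1 hyy

end IsEvenSL2
-- Isomorphism types of the normalizers, and their maximality
theorem nonempty_mulEquiv_dihedralGroup {G : Type*} [Group G] {n : ℕ} {C N : Subgroup G} {w : G}
    (e : Multiplicative (ZMod n) ≃* C) (hwC : w ∉ C) (hw : w * w = 1)
    (hwc : ∀ c ∈ C, w * c * w⁻¹ = c⁻¹) (hN : ∀ g, g ∈ N ↔ g ∈ C ∨ w * g ∈ C) :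
    Nonempty (N ≃* DihedralGroup n) := by
  let E (i : ZMod n) : G := e (Multiplicative.ofAdd i)
  have hEC (i : ZMod n) : E i ∈ C := (e _).2
  have hadd (i j : ZMod n) : E (i + j) = E i * E j := by simp [E, ofAdd_add]
  have hneg (i : ZMod n) : E (-i) = (E i)⁻¹ := by simp [E, ofAdd_neg]
  have hinj {i j : ZMod n} (h : E i = E j) : i = j := by
    simpa [E] using h
  have hsurj {c : G} (hc : c ∈ C) : ∃ i, E i = c :=
    ⟨(e.symm ⟨c, hc⟩).toAdd, by simp [E]⟩
  have hcw (i : ZMod n) : E i * w = w * E (-i) := by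
    have h1 := hwc (E (-i)) (hEC _)
    rw [mul_inv_eq_iff_eq_mul, hneg, inv_inv] at h1
    rw [hneg, h1]
  let f : DihedralGroup n →* G :=
    { toFun := fun d ↦ match d with
        | .r i => E i
        | .sr i => w * E i
      map_one' := by
        change E 0 = 1
        simp [E]
      map_mul' := by
        rintro (i | i) (j | j)
        · exact hadd i j
        · change w * E (j - i) = E i * (w * E j)
          rw [← mul_assoc, hcw, mul_assoc, ← hadd, neg_add_eq_sub]
        · change w * E (i + j) = w * E i * E j
          rw [hadd, mul_assoc]
        · change E (j - i) = w * E i * (w * E j)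
          rw [mul_assoc, ← mul_assoc (E i), hcw, mul_assoc, ← mul_assoc, hw, one_mul, ← hadd,
            neg_add_eq_sub] }
  have hf : Function.Injective f := by
    rintro (i | i) (j | j) hij
    · exact congrArg _ (hinj hij)
    · exact absurd (by
        have : E i = w * E j := hij
        rw [← mul_inv_eq_iff_eq_mul] at this
        rw [← this]; exact C.mul_mem (hEC _) (C.inv_mem (hEC _))) hwC
    · exact absurd (by
        have : w * E i = E j := hij
        rw [← eq_mul_inv_iff_mul_eq] at this
        rw [this]; exact C.mul_mem (hEC _) (C.inv_mem (hEC _))) hwC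
    · exact congrArg _ (hinj (mul_left_cancel (hij : w * E i = w * E j)))
  have hrange : f.range = N := by
    ext g
    rw [hN, MonoidHom.mem_range]
    constructor
    · rintro ⟨i | i, rfl⟩
      · exact Or.inl (hEC i)
      · right
        change w * (w * E i) ∈ C
        rw [← mul_assoc, hw, one_mul]
        exact hEC i
    · rintro (hg | hg)
      · obtain ⟨i, rfl⟩ := hsurj hg
        exact ⟨.r i, rfl⟩
      · obtain ⟨i, hi⟩ := hsurj hg
        refine ⟨.sr i, ?_⟩
        change w * E i = g
        rw [hi, ← mul_assoc, hw, one_mul]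
  exact ⟨((MonoidHom.ofInjective hf).trans (MulEquiv.subgroupCongr hrange)).symm⟩

theorem nonempty_mulEquiv_pi_zmod_two {A : Type*} [Group A] [Finite A] (hA : ∀ a : A, a * a = 1)
    {n : ℕ} (hn : Nat.card A = 2 ^ n) : Nonempty (A ≃* (Fin n → Multiplicative (ZMod 2))) := by
  have hinv (a : A) : a⁻¹ = a := inv_eq_of_mul_eq_one_left (hA a)
  have hcomm (a b : A) : a * b = b * a := by rw [← hinv (a * b), mul_inv_rev, hinv, hinv]
  let _ : CommGroup A := { mul_comm := hcomm }
  let _ : Module (ZMod 2) (Additive A) := AddCommGroup.zmodModule fun x ↦ by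
    rw [two_nsmul]; exact congrArg Additive.ofMul (hA x.toMul)
  have hfin : Module.Finite (ZMod 2) (Additive A) := Module.Finite.of_finite
  have hrank : Module.finrank (ZMod 2) (Additive A) = Module.finrank (ZMod 2) (Fin n → ZMod 2) := by
    have h1 := Module.natCard_eq_pow_finrank (K := ZMod 2) (V := Additive A)
    rw [show Nat.card (Additive A) = 2 ^ n from hn, Nat.card_zmod] at h1
    rw [Module.finrank_fin_fun]
    exact (Nat.pow_right_injective le_rfl h1).symm
  let e := LinearEquiv.ofFinrankEq _ _ hrank
  refine ⟨MulEquiv.mk' (Equiv.trans (Additive.ofMul.trans e.toEquiv)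
    (Equiv.piCongrRight fun _ ↦ Multiplicative.ofAdd)) fun a b ↦ ?_⟩
  funext i
  change Multiplicative.ofAdd (e (Additive.ofMul a + Additive.ofMul b) i) = _
  rw [map_add]
  rfl

theorem isBorelType_of_isComplement' {G : Type*} [Group G] [Finite G] {p : ℕ} {Q T : Subgroup G}
    [Q.Normal] (hQT : Q.IsComplement' T) (hQ : ∀ a ∈ Q, a * a = 1) (hQc : Nat.card Q = 2 ^ p)
    (hT : IsCyclic T) (hTc : Nat.card T = 2 ^ p - 1)
    (hc : ∀ t ∈ T, (∀ a ∈ Q, t * a = a * t) → t = 1) : Solubilizer.IsBorelType p G := by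
  obtain ⟨eQ⟩ := nonempty_mulEquiv_pi_zmod_two (A := Q) (fun a ↦ Subtype.ext (hQ a a.2)) hQc
  let eT : T ≃* Multiplicative (ZMod (2 ^ p - 1)) := (hTc ▸ zmodCyclicMulEquiv hT).symm
  let ψ : T →* MulAut Q := Q.normalizerMonoidHom.comp
    (Subgroup.inclusion (Q.normalizer_eq_top ▸ le_top))
  have hψ : Function.Injective ψ := by
    rw [injective_iff_map_eq_one]
    intro t ht
    refine Subtype.ext (hc t t.2 fun a ha ↦ ?_)
    have h1 : ψ t ⟨a, ha⟩ = ⟨a, ha⟩ := by rw [ht]; rfl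
    have h2 : (t : G) * a * (t : G)⁻¹ = a := congrArg Subtype.val h1
    exact mul_inv_eq_iff_eq_mul.1 h2
  let φ : Multiplicative (ZMod (2 ^ p - 1)) →* MulAut (Fin p → Multiplicative (ZMod 2)) :=
    (MulAut.congr eQ).toMonoidHom.comp (ψ.comp eT.symm.toMonoidHom)
  refine ⟨φ, (MulAut.congr eQ).injective.comp (hψ.comp eT.symm.injective), ?_⟩
  exact ⟨(SemidirectProduct.mulEquivSubgroup hQT).symm.trans
    (SemidirectProduct.congr eQ eT fun t ↦ by
      ext a
      simp [φ, ψ, MulAut.congr])⟩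

theorem card_of_isBorelType {p : ℕ} {H : Type*} [Group H] (hH : Solubilizer.IsBorelType p H) :
    Nat.card H = (2 ^ p - 1) * 2 ^ p := by
  obtain ⟨φ, -, ⟨e⟩⟩ := hH
  rw [Nat.card_congr e.toEquiv, SemidirectProduct.card, mul_comm]
  congr 1
  · exact Nat.card_zmod _
  · simp

theorem card_of_isDihedralType {n : ℕ} {H : Type*} [Group H]
    (hH : Solubilizer.IsDihedralType n H) : Nat.card H = 2 * n := by
  obtain ⟨e⟩ := hH
  rw [Nat.card_congr e.toEquiv, DihedralGroup.nat_card]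

namespace IsEvenSL2

variable {G : Type*} [Group G] {q : ℕ} (h : IsEvenSL2 q G)

include h

theorem exists_dihedral {x : G} (hx : x * x ≠ 1) :
    ∃ w, w * w = 1 ∧ w ∉ cent x ∧ (∀ c ∈ cent x, w * c * w⁻¹ = c⁻¹) ∧
      ∀ g, g ∈ normCent x ↔ g ∈ cent x ∨ w * g ∈ cent x := by
  obtain ⟨w, hw, hwx⟩ := h.exists_inverting x hx
  refine ⟨w, hw, fun hc ↦ not_commute_of_inverts hx hwx (mem_cent.1 hc),
    fun c hc ↦ h.inverts_of_commute hx hwx (mem_cent.1 hc), fun g ↦ ?_⟩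
  rw [h.mem_normCent_iff hx, mem_cent, mem_cent]
  refine or_congr_right ?_
  have hw' : w⁻¹ = w := inv_eq_of_mul_eq_one_left hw
  have e : Commute x (w * g) ↔ (w * g) * x * (w * g)⁻¹ = x := by
    rw [mul_inv_eq_iff_eq_mul]; exact eq_comm
  rw [e]
  have e2 : (w * g) * x * (w * g)⁻¹ = w * (g * x * g⁻¹) * w⁻¹ := by group
  have e3 : w * x⁻¹ * w⁻¹ = x := by rw [← conj_inv, hwx, inv_inv]
  rw [e2]
  constructor
  · intro h1
    rw [h1, e3]
  · intro h1
    have := h1.trans e3.symm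
    rwa [mul_left_inj, mul_right_inj] at this

theorem isDihedralType [Finite G] {x : G} (hx : x * x ≠ 1) :
    Solubilizer.IsDihedralType (Nat.card (cent x)) (normCent x) := by
  obtain ⟨w, hw, hwC, hwc, hN⟩ := h.exists_dihedral hx
  exact nonempty_mulEquiv_dihedralGroup (zmodCyclicMulEquiv (h.isCyclic x hx)) hwC hw hwc hN

theorem card_normCent [Finite G] {x : G} (hx : x * x ≠ 1) :
    Nat.card (normCent x) = 2 * Nat.card (cent x) :=
  card_of_isDihedralType (h.isDihedralType hx)

/-- The product of u and its conjugate by v commutes with both u and v. If it is not 1, transitivity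
of commuting applies; if it is 1, then v fixes u. -/
theorem commute_of_sq_of_mem_normCent {u v : G} (hu1 : u ≠ 1) (hu : u * u = 1) (hv : v * v = 1)
    (hvN : v ∈ normCent u) : Commute u v := by
  rw [h.mem_normCent hu1] at hvN
  have hv' : v⁻¹ = v := inv_eq_of_mul_eq_one_left hv
  by_cases h1 : u * (v * u * v⁻¹) = 1
  · have h2 : v * u * v⁻¹ = u := by rw [← inv_eq_of_mul_eq_one_right h1, inv_eq_of_mul_eq_one_left hu]
    exact (mul_inv_eq_iff_eq_mul.1 h2).symm
  · refine h.comm_trans (u * (v * u * v⁻¹)) u v h1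
      (Commute.mul_left (Commute.refl u) hvN.symm) ?_
    have : v * (u * (v * u * v⁻¹)) * v⁻¹ = u * (v * u * v⁻¹) := by
      calc v * (u * (v * u * v⁻¹)) * v⁻¹ = v * (v * u * v⁻¹ * u) * v⁻¹ := by rw [hvN.eq]
        _ = (v * v) * u * v⁻¹ * u * v⁻¹ := by group
        _ = u * (v * u * v⁻¹) := by rw [hv, hv']; group
    exact (mul_inv_eq_iff_eq_mul.1 this).symm

/-- The torus of x lies in a group of order (q - 1)q, and q + 1 does not divide that: it is coprime
to q and exceeds q - 1. -/
theorem card_cent_of_mem_normCent [Finite G] (hq : Even q) (hq4 : 4 ≤ q) {u x : G} (hu1 : u ≠ 1)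
    (hu : u * u = 1) (hx : x * x ≠ 1) (hxu : x ∈ normCent u) : Nat.card (cent x) = q - 1 := by
  refine (h.card_of_not_sq x hx).resolve_right fun e ↦ ?_
  have hle : cent x ≤ normCent u := fun y hy ↦
    h.cent_le_normCent_of_sq hq (by omega) hu1 hu hx hxu (mem_cent.1 hy)
  have hdvd := Subgroup.card_dvd_of_le hle
  rw [e, h.card_normCent_of_sq hq (by omega) hu1 hu] at hdvd
  have hco : Nat.Coprime (q + 1) q := by simp
  have := Nat.le_of_dvd (by omega) (hco.dvd_of_dvd_mul_right hdvd)
  omega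

theorem exists_mem_normCent [Finite G] (hq : Even q) (hq4 : 4 ≤ q) {u : G} (hu1 : u ≠ 1)
    (hu : u * u = 1) : ∃ x ∈ normCent u, x * x ≠ 1 := by
  by_contra! hc
  have : normCent u ≤ cent u := fun x hx ↦
    mem_cent.2 (h.commute_of_sq_of_mem_normCent hu1 hu (hc x hx) hx)
  have hle := Nat.le_of_dvd Nat.card_pos (Subgroup.card_dvd_of_le this)
  rw [h.card_normCent_of_sq hq (by omega) hu1 hu, h.card_of_sq u hu1 hu] at hle
  have : 3 * q ≤ (q - 1) * q := Nat.mul_le_mul_right _ (by omega)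
  omega

/-- The centralizer of u is normal of order q, and any torus inside the normalizer has coprime order
q - 1, so it is a complement. The action is faithful because no non-identity element of the torus
commutes with an involution. -/
theorem isBorelType [Finite G] {p : ℕ} (hqp : q = 2 ^ p) (hq : Even q) (hq4 : 4 ≤ q) {u : G}
    (hu1 : u ≠ 1) (hu : u * u = 1) : Solubilizer.IsBorelType p (normCent u) := by
  obtain ⟨x, hxN, hx⟩ := h.exists_mem_normCent hq hq4 hu1 hu
  have hle : cent x ≤ normCent u := fun y hy ↦
    h.cent_le_normCent_of_sq hq (by omega) hu1 hu hx hxN (mem_cent.1 hy)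
  have hcu : Nat.card ((cent u).subgroupOf (normCent u)) = q := by
    rw [Nat.card_congr (Subgroup.subgroupOfEquivOfLe (cent_le_normCent u)).toEquiv,
      h.card_of_sq u hu1 hu]
  have hcx : Nat.card ((cent x).subgroupOf (normCent u)) = q - 1 := by
    rw [Nat.card_congr (Subgroup.subgroupOfEquivOfLe hle).toEquiv,
      h.card_cent_of_mem_normCent hq hq4 hu1 hu hx hxN]
  have : ((cent u).subgroupOf (normCent u)).Normal := Subgroup.normal_in_normalizer
  refine isBorelType_of_isComplement' (Q := (cent u).subgroupOf (normCent u))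
    (T := (cent x).subgroupOf (normCent u)) ?_ ?_ (hcu.trans hqp) ?_ (hcx.trans (by rw [hqp])) ?_
  · refine Subgroup.isComplement'_of_coprime ?_ ?_
    · rw [hcu, hcx, h.card_normCent_of_sq hq (by omega) hu1 hu, mul_comm]
    · rw [hcu, hcx]
      exact (Nat.coprime_self_sub_right (by omega)).2 (by simp)
  · rintro ⟨a, haN⟩ ha
    exact Subtype.ext (h.sq_of_comm u a hu1 hu (mem_cent.1 ha))
  · exact (Subgroup.subgroupOfEquivOfLe hle).isCyclic.2 (h.isCyclic x hx)
  · rintro ⟨t, htN⟩ ht htc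
    by_contra hne
    have ht1 : t ≠ 1 := fun e ↦ hne (Subtype.ext e)
    have := htc ⟨u, cent_le_normCent u (mem_cent.2 (Commute.refl u))⟩ (mem_cent.2 (Commute.refl u))
    have htu : Commute u t := (congrArg Subtype.val this).symm
    exact h.mul_self_ne_of_commute hx ht1 (mem_cent.1 ht) (h.sq_of_comm u t hu1 hu htu)

/-- If u inverted x, then x² would be the product of u and its conjugate by x⁻¹, hence would lie in
the centralizer of u and have square 1. But x² is a non-identity element of the torus of x. -/
theorem not_inverts_of_mem_normCent {u x : G} (hu1 : u ≠ 1) (hu : u * u = 1)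
    (hx : x * x ≠ 1) (hxu : x ∈ normCent u) : u * x * u⁻¹ ≠ x⁻¹ := by
  intro hux
  have hcomm : Commute u (x⁻¹ * u * x⁻¹⁻¹) :=
    (h.mem_normCent hu1).1 ((normCent u).inv_mem hxu)
  have hxx : Commute u (u * (x⁻¹ * u * x⁻¹⁻¹)) := (Commute.refl u).mul_right hcomm
  have e : u * (x⁻¹ * u * x⁻¹⁻¹) = x * x := by
    calc u * (x⁻¹ * u * x⁻¹⁻¹) = (u * x * u⁻¹)⁻¹ * (u * u) * x := by group
      _ = x * x := by rw [hux, hu]; group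
  rw [e] at hxx
  exact h.mul_self_ne_of_commute hx hx ((Commute.refl x).mul_right (Commute.refl x))
    (h.sq_of_comm u _ hu1 hu hxx)

/-- This makes the normalizers pairwise incomparable, hence maximal, and lets a normalizer determine
its centralizer. The mixed cases are excluded as follows: two distinct commuting involutions and
their product cannot all invert y, and an involution inverting x cannot share a Borel subgroup with
x. -/
theorem cent_eq_of_normCent_le [Finite G] (hq3 : 3 ≤ q) {x y : G} (hx1 : x ≠ 1) (hy1 : y ≠ 1)
    (hle : normCent x ≤ normCent y) : cent x = cent y := by
  have hxy : x ∈ normCent y := hle (cent_le_normCent x (mem_cent.2 (Commute.refl x)))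
  by_cases hx : x * x = 1
  · by_cases hy : y * y = 1
    · exact (h.cent_eq hy1 hx1 (h.commute_of_sq_of_mem_normCent hy1 hy hx hxy)).symm
    · exfalso
      obtain ⟨v, hv, hv1, hvx⟩ : ∃ v ∈ cent x, v ≠ 1 ∧ v ≠ x := by
        by_contra! hc
        have : ((cent x : Subgroup G) : Set G) ⊆ {1, x} := fun v hv ↦ by
          by_cases hv1 : v = 1
          · exact Or.inl hv1
          · exact Or.inr (hc v hv hv1)
        have h1 := (Set.ncard_le_ncard this).trans (Set.ncard_pair hx1.symm).le
        have h2 : ((cent x : Subgroup G) : Set G).ncard = q := h.card_of_sq x hx1 hx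
        omega
      have hxv := mem_cent.1 hv
      have hvv := h.sq_of_comm x v hx1 hx hxv
      have key (z : G) (hz1 : z ≠ 1) (hz : z ∈ cent x) : y * y ≠ 1 ∧ z * y * z⁻¹ = y⁻¹ := by
        refine ⟨hy, ((h.mem_normCent_iff hy).1 (hle (cent_le_normCent x hz))).resolve_left ?_⟩
        intro hc
        exact h.mul_self_ne_of_commute hy hz1 hc (h.sq_of_comm x z hx1 hx (mem_cent.1 hz))
      have h1 := (key x hx1 (mem_cent.2 (Commute.refl x))).2
      have h2 := (key v hv1 hv).2
      have hxv1 : x * v ≠ 1 := fun e ↦ hvx (by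
        rw [← inv_eq_of_mul_eq_one_right e, inv_eq_of_mul_eq_one_left hx])
      have h3 := (key (x * v) hxv1 (mem_cent.2 ((Commute.refl x).mul_right hxv))).2
      have h4 : x * v * y * (x * v)⁻¹ = y := by
        calc x * v * y * (x * v)⁻¹ = x * (v * y * v⁻¹) * x⁻¹ := by group
          _ = (x * y * x⁻¹)⁻¹ := by rw [h2]; group
          _ = y := by rw [h1, inv_inv]
      rw [h4] at h3
      exact hy (mul_eq_one_iff_eq_inv.2 h3)
  · by_cases hy : y * y = 1
    · exfalso
      obtain ⟨w, hw, hwx⟩ := h.exists_inverting x hx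
      have hwN := hle (h.mem_normCent_of_inverts hx hwx)
      have hyw := h.commute_of_sq_of_mem_normCent hy1 hy hw hwN
      have hw1 : w ≠ 1 := by
        rintro rfl
        exact not_commute_of_inverts hx hwx (Commute.one_right x)
      refine h.not_inverts_of_mem_normCent hw1 hw hx ?_ hwx
      rw [normCent, ← h.cent_eq hy1 hw1 hyw]
      exact hxy
    · refine (h.cent_eq hy1 hx1 ?_).symm
      refine ((h.mem_normCent_iff hy).1 hxy).resolve_right fun hc ↦ hx ?_
      exact h.mul_self_of_inverts hy hc

theorem normCent_ne_top [Finite G] (hq3 : 3 ≤ q) {x : G} (hx1 : x ≠ 1) : normCent x ≠ ⊤ := by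
  intro htop
  have key (u : G) (hu1 : u ≠ 1) : Commute x u := by
    have := h.cent_eq_of_normCent_le hq3 hu1 hx1 (htop ▸ le_top)
    exact mem_cent.1 (this ▸ mem_cent.2 (Commute.refl u))
  obtain ⟨u, hu1, hu, -⟩ := h.exists_base
  obtain ⟨v, hv, huv⟩ := h.exists_not_commute (by omega) hu1 hu
  have hv1 : v ≠ 1 := by rintro rfl; exact huv (Commute.one_right u)
  exact huv (h.comm_trans x u v hx1 (key u hu1) (key v hv1))

theorem isCoatom_iff [Finite G] {p : ℕ} (hp : p.Prime) (hqp : q = 2 ^ p) (hq3 : 3 ≤ q)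
    {M : Subgroup G} : IsCoatom M ↔ ∃ x, x ≠ 1 ∧ M = normCent x := by
  constructor
  · intro hM
    obtain ⟨x, hx1, hle⟩ := h.exists_le_normCent hp hqp hM.1
    exact ⟨x, hx1, hle.eq_of_not_lt fun hlt ↦ h.normCent_ne_top hq3 hx1 (hM.2 _ hlt)⟩
  · rintro ⟨x, hx1, rfl⟩
    refine ⟨h.normCent_ne_top hq3 hx1, fun H hH ↦ ?_⟩
    by_contra hne
    obtain ⟨y, hy1, hle⟩ := h.exists_le_normCent hp hqp hne
    have := h.cent_eq_of_normCent_le hq3 hx1 hy1 (hH.le.trans hle)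
    have e : normCent x = normCent y := by rw [normCent, this]
    exact absurd (e ▸ hle) hH.not_ge

end IsEvenSL2
-- Solubility, and the solubilizer as a union of maximal subgroups
theorem isSolvable_of_isBorelType {p : ℕ} {H : Type*} [Group H]
    (hH : Solubilizer.IsBorelType p H) : Group.IsSolvable H := by
  obtain ⟨φ, -, ⟨e⟩⟩ := hH
  have : Group.IsSolvable ((Fin p → Multiplicative (ZMod 2)) ⋊[φ] Multiplicative (ZMod (2 ^ p - 1))) :=
    Group.isSolvable_of_ker_le_range SemidirectProduct.inl SemidirectProduct.rightHom
      SemidirectProduct.range_inl_eq_ker_rightHom.ge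
  exact Group.isSolvable_of_isSolvable_injective (f := e.toMonoidHom) e.injective

namespace IsEvenSL2

variable {G : Type*} [Group G] {q : ℕ} (h : IsEvenSL2 q G)

include h

theorem isSolvable_normCent [Finite G] {p : ℕ} (hqp : q = 2 ^ p) (hq : Even q) (hq4 : 4 ≤ q)
    {x : G} (hx1 : x ≠ 1) : Group.IsSolvable (normCent x) := by
  by_cases hx : x * x = 1
  · exact isSolvable_of_isBorelType (h.isBorelType hqp hq hq4 hx1 hx)
  · have : ((cent x).subgroupOf (normCent x)).Normal := Subgroup.normal_in_normalizer
    refine (Group.isSolvable_iff_subgroup_quotient ((cent x).subgroupOf (normCent x))).2 ⟨?_, ?_⟩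
    · refine Group.isSolvable_of_comm ?_
      rintro ⟨⟨a, _⟩, ha⟩ ⟨⟨b, _⟩, hb⟩
      exact Subtype.ext (Subtype.ext (h.comm_trans x a b hx1 (mem_cent.1 ha) (mem_cent.1 hb)))
    · have h1 := Subgroup.card_eq_card_quotient_mul_card_subgroup ((cent x).subgroupOf (normCent x))
      rw [h.card_normCent hx, Nat.card_congr
        (Subgroup.subgroupOfEquivOfLe (cent_le_normCent x)).toEquiv] at h1
      have h2 := (Nat.eq_of_mul_eq_mul_right Nat.card_pos h1).symm
      have : Fact (Nat.Prime 2) := ⟨Nat.prime_two⟩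
      have hcyc := isCyclic_of_prime_card h2
      refine Group.isSolvable_of_comm fun a b ↦ ?_
      obtain ⟨g, hg⟩ := hcyc
      obtain ⟨m, rfl⟩ := hg a
      obtain ⟨n, rfl⟩ := hg b
      exact (Commute.refl g).zpow_zpow m n

/-- G is perfect: the commutator subgroup contains every involution centralizer, and two of these
generate G. -/
theorem not_isSolvable [Finite G] (hq : Even q) (hq4 : 4 ≤ q) : ¬ Group.IsSolvable G := by
  intro hsol
  have hle {u : G} (hu1 : u ≠ 1) (hu : u * u = 1) : cent u ≤ commutator G := by
    obtain ⟨x, hxN, hx⟩ := h.exists_mem_normCent hq hq4 hu1 hu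
    -- The map v ↦ [x, v] is injective, because x commutes with no involution; by finiteness every
    -- element of the centralizer is a commutator.
    let f : cent u → cent u := fun v ↦ ⟨x * v * x⁻¹ * (v : G)⁻¹,
      (cent u).mul_mem ((Subgroup.mem_normalizer_iff.1 hxN v).1 v.2) ((cent u).inv_mem v.2)⟩
    have hf : Function.Injective f := by
      rintro ⟨v, hv⟩ ⟨w, hw⟩ hvw
      have e : x * v * x⁻¹ * v⁻¹ = x * w * x⁻¹ * w⁻¹ := congrArg Subtype.val hvw
      have hxw := (Subgroup.mem_normalizer_iff.1 hxN w).1 hw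
      have hc : Commute x (w⁻¹ * v) := by
        have c1 : Commute w⁻¹ (x * w * x⁻¹) :=
          (h.comm_trans u w _ hu1 (mem_cent.1 hw) (mem_cent.1 hxw)).inv_left
        have e1 : x * v * x⁻¹ = x * w * x⁻¹ * (w⁻¹ * v) := by
          rw [mul_inv_eq_iff_eq_mul] at e
          rw [e, mul_assoc]
        have e2 : x * (w⁻¹ * v) * x⁻¹ = w⁻¹ * v := by
          calc x * (w⁻¹ * v) * x⁻¹ = (x * w * x⁻¹)⁻¹ * (x * v * x⁻¹) := by group
            _ = w⁻¹ * v := by rw [e1, inv_mul_cancel_left]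
        exact mul_inv_eq_iff_eq_mul.1 e2
      by_contra hne
      have hwv : w⁻¹ * v ≠ 1 := fun e ↦ hne (Subtype.ext (inv_mul_eq_one.1 e).symm)
      exact h.mul_self_ne_of_commute hx hwv hc (h.sq_of_comm u _ hu1 hu
        (mem_cent.1 ((cent u).mul_mem ((cent u).inv_mem hw) hv)))
    intro v hv
    obtain ⟨w, hw⟩ := Finite.surjective_of_injective hf ⟨v, hv⟩
    have : x * w * x⁻¹ * (w : G)⁻¹ = v := congrArg Subtype.val hw
    rw [← this, commutator_def]
    exact Subgroup.commutator_mem_commutator (Subgroup.mem_top _) (Subgroup.mem_top _)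
  obtain ⟨u, hu1, hu, -⟩ := h.exists_base
  obtain ⟨v, hv, huv⟩ := h.exists_not_commute (by omega) hu1 hu
  have hv1 : v ≠ 1 := by rintro rfl; exact huv (Commute.one_right u)
  have : Nontrivial G := ⟨u, 1, hu1⟩
  exact (Group.IsSolvable.commutator_lt_top_of_nontrivial G).ne
    (h.eq_top_of_cent_le hq (by omega) hu hv huv (hle hu1 hu) (hle hv1 hv))

theorem solubilizer_eq [Finite G] {p : ℕ} (hp : p.Prime) (hqp : q = 2 ^ p) (hq : Even q)
    (hq4 : 4 ≤ q) (x : G) :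
    Solubilizer.solubilizer x = ⋃ M ∈ Solubilizer.maximalContaining x, (M : Set G) := by
  ext y
  simp only [Solubilizer.solubilizer, Solubilizer.maximalContaining, Set.mem_ofPred_eq,
    Set.mem_iUnion, SetLike.mem_coe, exists_prop]
  constructor
  · intro hsol
    have hne : Subgroup.closure ({x, y} : Set G) ≠ ⊤ := by
      intro htop
      rw [htop] at hsol
      exact h.not_isSolvable hq hq4 (Group.isSolvable_of_isSolvable_injective
        (f := (Subgroup.topEquiv (G := G)).symm.toMonoidHom) Subgroup.topEquiv.symm.injective)
    obtain ⟨z, hz1, hle⟩ := h.exists_le_normCent hp hqp hne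
    exact ⟨normCent z, ⟨(h.isCoatom_iff hp hqp (by omega)).2 ⟨z, hz1, rfl⟩,
      hle (Subgroup.subset_closure (by simp))⟩, hle (Subgroup.subset_closure (by simp))⟩
  · rintro ⟨M, ⟨hM, hxM⟩, hyM⟩
    obtain ⟨z, hz1, rfl⟩ := (h.isCoatom_iff hp hqp (by omega)).1 hM
    have := h.isSolvable_normCent hqp hq hq4 hz1
    have hle : Subgroup.closure ({x, y} : Set G) ≤ normCent z := by
      rw [Subgroup.closure_le]
      rintro _ (rfl | rfl)
      · exact hxM
      · exact hyM
    exact Group.isSolvable_of_isSolvable_injective (Subgroup.inclusion_injective hle)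

end IsEvenSL2
-- Counting Borel subgroups and torus normalizers through an element
theorem card_mul_card_le_of_disjoint {G : Type*} [Group G] {A B M : Subgroup G} [Finite M]
    (hAB : Disjoint A B) (hA : A ≤ M) (hB : B ≤ M) : Nat.card A * Nat.card B ≤ Nat.card M := by
  rw [← Nat.card_prod]
  refine Nat.card_le_card_of_injective
    (fun c : A × B ↦ (⟨c.1 * c.2, M.mul_mem (hA c.1.2) (hB c.2.2)⟩ : M)) fun c d hcd ↦ ?_
  exact Subgroup.mul_injective_of_disjoint hAB (congrArg Subtype.val hcd)

/-- The normalizers of centralizers of involutions that contain `x`. -/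
def borels {G : Type*} [Group G] (x : G) : Set (Subgroup G) :=
  {M | ∃ u, u ≠ 1 ∧ u * u = 1 ∧ M = normCent u ∧ x ∈ M}

/-- The normalizers containing `x` of tori of order `n`. -/
def torusNormalizers {G : Type*} [Group G] (n : ℕ) (x : G) : Set (Subgroup G) :=
  {M | ∃ y, y * y ≠ 1 ∧ Nat.card (cent y) = n ∧ M = normCent y ∧ x ∈ M}

theorem conj_mem_normCent {G : Type*} [Group G] {a g u : G} :
    a * g * a⁻¹ ∈ normCent (a * u * a⁻¹) ↔ g ∈ normCent u := by
  have e (y : G) : a * y * a⁻¹ ∈ cent (a * u * a⁻¹) ↔ y ∈ cent u := by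
    rw [mem_cent, mem_cent, commute_conj_iff]
  rw [Subgroup.mem_normalizer_iff, Subgroup.mem_normalizer_iff]
  constructor
  · intro H y
    rw [← e, H, ← e (g * y * g⁻¹)]
    have : a * g * a⁻¹ * (a * y * a⁻¹) * (a * g * a⁻¹)⁻¹ = a * (g * y * g⁻¹) * a⁻¹ := by group
    rw [this]
  · intro H y
    obtain ⟨z, rfl⟩ : ∃ z, a * z * a⁻¹ = y := ⟨a⁻¹ * y * a, by group⟩
    have : a * g * a⁻¹ * (a * z * a⁻¹) * (a * g * a⁻¹)⁻¹ = a * (g * z * g⁻¹) * a⁻¹ := by group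
    rw [this, e, e, H]

namespace IsEvenSL2

variable {G : Type*} [Group G] {q : ℕ} (h : IsEvenSL2 q G)

include h

theorem inverts_of_mem_normCent {u x : G} (hu1 : u ≠ 1) (hu : u * u = 1)
    (hx : x * x ≠ 1) (hux : u ∈ normCent x) : u * x * u⁻¹ = x⁻¹ :=
  ((h.mem_normCent_iff hx).1 hux).resolve_left fun hc ↦ h.mul_self_ne_of_commute hx hu1 hc hu

theorem commute_of_mem_normCent {x y : G} (hx : x * x ≠ 1) (hy : y * y ≠ 1)
    (hyx : y ∈ normCent x) : Commute x y :=
  ((h.mem_normCent_iff hx).1 hyx).resolve_right fun hc ↦ hy (h.mul_self_of_inverts hx hc)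

theorem cent_inj_of_normCent_eq [Finite G] (hq3 : 3 ≤ q) {x y : G} (hx1 : x ≠ 1) (hy1 : y ≠ 1) :
    normCent x = normCent y ↔ cent x = cent y :=
  ⟨fun e ↦ h.cent_eq_of_normCent_le hq3 hx1 hy1 e.le, fun e ↦ by rw [normCent, e]⟩

/-- Every element outside the involution centralizers whose centralizer has order `q - 1` lies in
exactly two conjugates of the normalizer of an involution centralizer. -/
theorem ncard_borels_of_card_eq [Finite G] (hq : Even q) (hq4 : 4 ≤ q) {x : G} (hx : x * x ≠ 1)
    (hxc : Nat.card (cent x) = q - 1) : (borels x).ncard = 2 := by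
  classical
  have hx1 := ne_one_of_mul_self_ne hx
  obtain ⟨u, hu1, hu, -⟩ := h.exists_base
  let Ω := G ⧸ normCent u
  have hΩ : Nat.card Ω = q + 1 := by
    have h1 := Subgroup.card_eq_card_quotient_mul_card_subgroup (normCent u)
    rw [h.card_eq hq (by omega), h.card_normCent_of_sq hq (by omega) hu1 hu] at h1
    have h2 : (q ^ 2 - 1) * q = (q + 1) * ((q - 1) * q) := by
      rw [← mul_assoc, ← one_pow 2, Nat.sq_sub_sq, one_pow]
    rw [h2] at h1
    exact (Nat.eq_of_mul_eq_mul_right (Nat.mul_pos (by omega) (by omega)) h1).symm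
  have hmem (g a : G) : g • (a : Ω) = (a : Ω) ↔ g ∈ normCent (a * u * a⁻¹) := by
    have e : g = a * (a⁻¹ * g * a) * a⁻¹ := by group
    conv_rhs => rw [e, conj_mem_normCent]
    rw [← Subgroup.inv_mem_iff]
    change ((g * a : G) : Ω) = _ ↔ _
    rw [QuotientGroup.eq]
    simp [mul_assoc]
  have hsq (a : G) : (a * u * a⁻¹) * (a * u * a⁻¹) = 1 := conj_mul_self.2 hu
  have hne (a : G) : a * u * a⁻¹ ≠ 1 := conj_eq_one.not.2 hu1
  have hB : (borels x).ncard = {ω : Ω | x • ω = ω}.ncard := by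
    refine (Set.ncard_congr' (Equiv.ofBijective
      (fun ω : {ω : Ω | x • ω = ω} ↦ (⟨normCent (ω.1.out * u * ω.1.out⁻¹), _, hne _, hsq _, rfl, ?_⟩ :
        borels x)) ⟨?_, ?_⟩)).symm
    · rw [← hmem, QuotientGroup.out_eq']
      exact ω.2
    · rintro ⟨ω, hω⟩ ⟨ω', hω'⟩ e
      have e := congrArg Subtype.val e
      simp only at e
      rw [h.cent_inj_of_normCent_eq (by omega) (hne _) (hne _)] at e
      refine Subtype.ext ?_
      change ω = ω'
      rw [← QuotientGroup.out_eq' ω, ← QuotientGroup.out_eq' ω', QuotientGroup.eq,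
        h.mem_normCent hu1, ← commute_conj_iff (g := ω.out)]
      have : Commute (ω.out * u * ω.out⁻¹) (ω'.out * u * ω'.out⁻¹) :=
        mem_cent.1 (e ▸ mem_cent.2 (Commute.refl _))
      convert this using 1
      group
    · rintro ⟨M, v, hv1, hv, rfl, hxM⟩
      obtain ⟨a, rfl⟩ := h.isConj_of_involutions hq (by omega) hu1 hu hv1 hv
      refine ⟨⟨(a : Ω), (hmem x a).2 hxM⟩, Subtype.ext ?_⟩
      simp only
      rw [h.cent_inj_of_normCent_eq (by omega) (hne _) (hne _)]
      refine h.cent_eq (hne _) (hne _) ?_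
      have e1 : ((a : Ω).out : Ω) = (a : Ω) := QuotientGroup.out_eq' _
      rw [QuotientGroup.eq, h.mem_normCent hu1, ← commute_conj_iff (g := (a : Ω).out)] at e1
      convert e1 using 1
      group
  rw [hB]
  -- A Borel subgroup containing one non-identity element of the torus contains all of it, so each
  -- of the q - 2 non-identity elements has the same f fixed points.
  set f := {ω : Ω | x • ω = ω}.ncard with hf
  have hfix (c : cent x) (hc : c ≠ 1) : Nat.card (MulAction.fixedBy Ω c) = f := by
    have hc1 : (c : G) ≠ 1 := fun e ↦ hc (Subtype.ext e)
    have hcx := mem_cent.1 c.2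
    have hcc := h.mul_self_ne_of_commute hx hc1 hcx
    have : MulAction.fixedBy Ω c = {ω : Ω | x • ω = ω} := by
      ext ω
      obtain ⟨a, rfl⟩ := QuotientGroup.mk_surjective ω
      change (c : G) • (a : Ω) = (a : Ω) ↔ x • (a : Ω) = (a : Ω)
      rw [hmem, hmem]
      exact ⟨fun k ↦ h.cent_le_normCent_of_sq hq (by omega) (hne _) (hsq _) hcc k hcx.symm,
        fun k ↦ h.cent_le_normCent_of_sq hq (by omega) (hne _) (hsq _) hx k hcx⟩
    rw [this, hf]
    exact Nat.card_coe_set_eq _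
  have hburn : (q + 1) + (q - 2) * f = Nat.card (Quotient (MulAction.orbitRel (cent x) Ω)) * (q - 1) := by
    have : Fintype (cent x) := Fintype.ofFinite _
    have : Fintype Ω := Fintype.ofFinite _
    have key := MulAction.sum_card_fixedBy_eq_card_orbits_mul_card_group (cent x) Ω
    rw [← Nat.card_eq_fintype_card, ← Nat.card_eq_fintype_card, hxc] at key
    rw [← key, ← Finset.add_sum_erase _ _ (Finset.mem_univ (1 : cent x))]
    congr 1
    · rw [← hΩ, ← Nat.card_eq_fintype_card]
      refine Nat.card_congr (Equiv.symm ((Equiv.setCongr ?_).trans (Equiv.Set.univ Ω)))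
      ext ω
      simp
    · rw [Finset.sum_congr rfl (g := fun _ ↦ f) (fun c hc ↦ by
        rw [← Nat.card_eq_fintype_card, hfix c (Finset.ne_of_mem_erase hc)]),
        Finset.sum_const, smul_eq_mul, Finset.card_erase_of_mem (Finset.mem_univ _),
        Finset.card_univ, ← Nat.card_eq_fintype_card, hxc]
      congr 1
  -- The Borel subgroup of an involution inverting x does not contain x.
  have hlt : f < q + 1 := by
    rw [← hΩ, ← Set.ncard_univ]
    refine Set.ncard_lt_ncard ?_
    rw [Set.ssubset_univ_iff]
    intro huniv
    obtain ⟨w, hw, hwx⟩ := h.exists_inverting x hx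
    have hw1 : w ≠ 1 := by
      rintro rfl
      exact not_commute_of_inverts hx hwx (Commute.one_right x)
    obtain ⟨a, rfl⟩ := h.isConj_of_involutions hq (by omega) hu1 hu hw1 hw
    have : (a : Ω) ∈ {ω : Ω | x • ω = ω} := huniv ▸ Set.mem_univ _
    exact h.not_inverts_of_mem_normCent (hne a) hw hx ((hmem x a).1 this) hwx
  obtain ⟨m, rfl⟩ : ∃ m, q = m + 4 := ⟨q - 4, by omega⟩
  generalize Nat.card (Quotient (MulAction.orbitRel (cent x) Ω)) = o at hburn
  have e1 : m + 4 - 2 = m + 2 := by omega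
  have e2 : m + 4 - 1 = m + 3 := by omega
  rw [e1, e2] at hburn
  clear_value f
  -- Burnside's count says f ≡ 2 modulo q - 1 = m + 3. Since f < q + 1 = 2 + (q - 1), the only
  -- solution is f = 2.
  have hburn' : (m + 3) * (f + 1) + 2 = (m + 3) * o + f := by nlinarith
  rcases Nat.lt_or_ge f 2 with hf2 | hf2
  · have : o = f + 1 ∨ o ≤ f ∨ f + 2 ≤ o := by omega
    rcases this with rfl | ho | ho
    · omega
    · nlinarith
    · nlinarith
  · rcases Nat.lt_or_ge (f + 1) (o + 1) with ho | ho
    · nlinarith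
    · obtain ⟨k, hk⟩ : ∃ k, f + 1 = o + k := ⟨f + 1 - o, by omega⟩
      have h3 : (m + 3) * k + 2 = f := by
        rw [hk] at hburn'; nlinarith
      rcases k with _ | _ | k
      · omega
      · omega
      · nlinarith

end IsEvenSL2
namespace IsEvenSL2

variable {G : Type*} [Group G] {q : ℕ} (h : IsEvenSL2 q G)

include h

theorem mul_self_ne_of_mem_inf {u v y : G} (hu1 : u ≠ 1) (hu : u * u = 1) (hv1 : v ≠ 1)
    (hv : v * v = 1) (huv : ¬ Commute u v) (hy1 : y ≠ 1) (hyu : y ∈ normCent u)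
    (hyv : y ∈ normCent v) : y * y ≠ 1 := fun hy ↦
  huv (h.comm_trans y u v hy1 (h.commute_of_sq_of_mem_normCent hu1 hu hy hyu).symm
    (h.commute_of_sq_of_mem_normCent hv1 hv hy hyv).symm)

/-- Two conjugates of the normalizer of an involution centralizer meet in a torus. -/
theorem inf_eq_cent [Finite G] (hq : Even q) (hq4 : 4 ≤ q) {u v y : G} (hu1 : u ≠ 1)
    (hu : u * u = 1) (hv1 : v ≠ 1) (hv : v * v = 1) (huv : ¬ Commute u v) (hy1 : y ≠ 1)
    (hyu : y ∈ normCent u) (hyv : y ∈ normCent v) : normCent u ⊓ normCent v = cent y := by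
  have hy := h.mul_self_ne_of_mem_inf hu1 hu hv1 hv huv hy1 hyu hyv
  symm
  refine Subgroup.eq_of_le_of_card_ge (fun z hz ↦
    ⟨h.cent_le_normCent_of_sq hq (by omega) hu1 hu hy hyu (mem_cent.1 hz),
      h.cent_le_normCent_of_sq hq (by omega) hv1 hv hy hyv (mem_cent.1 hz)⟩) ?_
  rw [h.card_cent_of_mem_normCent hq hq4 hu1 hu hy hyu]
  -- The intersection contains no involution, so it embeds in the quotient of the Borel subgroup by
  -- its normal subgroup of order q and has order at most q - 1.
  have hdisj : Disjoint (normCent u ⊓ normCent v) (cent u) := by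
    rw [Subgroup.disjoint_def]
    rintro z ⟨hzu, hzv⟩ hz
    by_contra hz1
    exact h.mul_self_ne_of_mem_inf hu1 hu hv1 hv huv hz1 hzu hzv
      (h.sq_of_comm u z hu1 hu (mem_cent.1 hz))
  have := card_mul_card_le_of_disjoint hdisj inf_le_left (cent_le_normCent u)
  rw [h.card_of_sq u hu1 hu, h.card_normCent_of_sq hq (by omega) hu1 hu] at this
  exact Nat.le_of_mul_le_mul_right this (by omega)

/-- Two Borel subgroups meeting trivially would give ((q - 1)q)² distinct products, more than the
order of G. -/
theorem exists_mem_inf [Finite G] (hq : Even q) (hq4 : 4 ≤ q) {u v : G} (hu1 : u ≠ 1)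
    (hu : u * u = 1) (hv1 : v ≠ 1) (hv : v * v = 1) :
    ∃ y, y ≠ 1 ∧ y ∈ normCent u ∧ y ∈ normCent v := by
  by_contra! hc
  have hdisj : Disjoint (normCent u) (normCent v) := by
    rw [Subgroup.disjoint_def]
    intro y hyu hyv
    by_contra hy1
    exact hc y hy1 hyu hyv
  have := card_mul_card_le_of_disjoint (M := ⊤) hdisj le_top le_top
  rw [h.card_normCent_of_sq hq (by omega) hu1 hu, h.card_normCent_of_sq hq (by omega) hv1 hv,
    Subgroup.card_top, h.card_eq hq (by omega)] at this
  obtain ⟨m, rfl⟩ : ∃ m, q = m + 4 := ⟨q - 4, by omega⟩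
  have e1 : m + 4 - 1 = m + 3 := by omega
  have e2 : (m + 4) ^ 2 - 1 = (m + 3) * (m + 5) := by
    rw [← one_pow 2, Nat.sq_sub_sq, e1, mul_comm]
    ring
  rw [e1, e2] at this
  have h1 : (m + 3) * (m + 4) * ((m + 3) * (m + 4)) ≤ (m + 3) * (m + 4) * (m + 5) := by nlinarith
  have := Nat.le_of_mul_le_mul_left h1 (by positivity)
  nlinarith

/-- Containing 1 is no condition, so this counts all Borel subgroups. They partition the q² - 1
involutions into sets of size q - 1. -/
theorem ncard_borels_one [Finite G] (hq4 : 4 ≤ q) :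
    (borels (1 : G)).ncard = q + 1 := by
  classical
  have hd : (borels (1 : G)).PairwiseDisjoint (fun M ↦ {v : G | v ≠ 1 ∧ v * v = 1 ∧ v ∈ M}) := by
    rintro M ⟨u, hu1, hu, rfl, -⟩ N ⟨v, hv1, hv, rfl, -⟩ hMN
    rw [Function.onFun, Set.disjoint_left]
    rintro w ⟨hw1, hw, hwu⟩ ⟨-, -, hwv⟩
    apply hMN
    rw [h.cent_inj_of_normCent_eq (by omega) hu1 hv1]
    exact h.cent_eq hu1 hv1 (h.comm_trans w u v hw1
      (h.commute_of_sq_of_mem_normCent hu1 hu hw hwu).symm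
      (h.commute_of_sq_of_mem_normCent hv1 hv hw hwv).symm)
  have hm : ∀ M ∈ borels (1 : G), {v : G | v ≠ 1 ∧ v * v = 1 ∧ v ∈ M}.ncard = q - 1 := by
    rintro M ⟨u, hu1, hu, rfl, -⟩
    have : {v : G | v ≠ 1 ∧ v * v = 1 ∧ v ∈ normCent u} = (cent u : Set G) \ {1} := by
      ext v
      simp only [Set.mem_ofPred_eq, Set.mem_sdiff, SetLike.mem_coe, Set.mem_singleton_iff]
      constructor
      · rintro ⟨hv1, hv, hvu⟩
        exact ⟨mem_cent.2 (h.commute_of_sq_of_mem_normCent hu1 hu hv hvu), hv1⟩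
      · rintro ⟨hv, hv1⟩
        exact ⟨hv1, h.sq_of_comm u v hu1 hu (mem_cent.1 hv), cent_le_normCent u hv⟩
    rw [this, Set.ncard_sdiff_singleton_of_mem (Subgroup.one_mem _)]
    congr 1
    exact h.card_of_sq u hu1 hu
  have key := ncard_biUnion_const hd hm
  have hall : (⋃ M ∈ borels (1 : G), {v : G | v ≠ 1 ∧ v * v = 1 ∧ v ∈ M}) =
      {w : G | w ≠ 1 ∧ w * w = 1} := by
    ext w
    simp only [Set.mem_iUnion, Set.mem_ofPred_eq]
    constructor
    · rintro ⟨M, -, h1, h2, -⟩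
      exact ⟨h1, h2⟩
    · rintro ⟨h1, h2⟩
      exact ⟨normCent w, ⟨w, h1, h2, rfl, Subgroup.one_mem _⟩, h1, h2,
        cent_le_normCent w (mem_cent.2 (Commute.refl w))⟩
  rw [hall, h.ncard_involutions, ← one_pow 2, Nat.sq_sub_sq, one_pow] at key
  exact (Nat.eq_of_mul_eq_mul_right (by omega) key).symm

theorem borels_eq_singleton {u : G} (hu1 : u ≠ 1) (hu : u * u = 1) :
    borels u = {normCent u} := by
  ext M
  constructor
  · rintro ⟨v, hv1, hv, rfl, huv⟩
    have := h.cent_eq hv1 hu1 (h.commute_of_sq_of_mem_normCent hv1 hv hu huv)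
    simp only [Set.mem_singleton_iff, normCent, this]
  · rintro rfl
    exact ⟨u, hu1, hu, rfl, cent_le_normCent u (mem_cent.2 (Commute.refl u))⟩

theorem normCent_eq_iff {x y : G} (hx : x * x ≠ 1) (hy : y * y ≠ 1) :
    normCent x = normCent y ↔ Commute x y := by
  constructor
  · intro e
    exact h.commute_of_mem_normCent hx hy
      (e.symm ▸ cent_le_normCent y (mem_cent.2 (Commute.refl y)))
  · intro e
    rw [normCent, h.cent_eq (ne_one_of_mul_self_ne hx) (ne_one_of_mul_self_ne hy) e]

/-- Double counting of pairs of a conjugate of the normalizer of an involution centralizer, and a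
torus in it that is inverted by `u`. -/
theorem ncard_torusNormalizers_sub [Finite G] (hq : Even q) (hq4 : 4 ≤ q) {u : G} (hu1 : u ≠ 1)
    (hu : u * u = 1) : (torusNormalizers (q - 1) u).ncard = q / 2 := by
  classical
  have hu' : u⁻¹ = u := inv_eq_of_mul_eq_one_left hu
  let s : Finset (Subgroup G) := (Set.toFinite (borels (1 : G) \ {normCent u})).toFinset
  let t : Finset (Subgroup G) := (Set.toFinite (torusNormalizers (q - 1) u)).toFinset
  let r (M D : Subgroup G) : Prop := ∃ y, y * y ≠ 1 ∧ D = normCent y ∧ y ∈ M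
  have hs : s.card = q := by
    rw [← Set.ncard_eq_toFinset_card, Set.ncard_sdiff_singleton_of_mem
      (show normCent u ∈ borels 1 from ⟨u, hu1, hu, rfl, Subgroup.one_mem _⟩), h.ncard_borels_one hq4, Nat.add_sub_cancel]
  have ht : t.card = (torusNormalizers (q - 1) u).ncard := (Set.ncard_eq_toFinset_card _).symm
  -- A torus in M inverted by u also lies in the conjugate of M by u. The intersection of these two
  -- Borel subgroups is a single torus, and u normalizes it.
  have h1 : ∀ M ∈ s, (t.bipartiteAbove r M).card = 1 := by
    intro M hM
    simp only [s, Set.Finite.mem_toFinset] at hM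
    obtain ⟨⟨v, hv1, hv, rfl, -⟩, hne⟩ := hM
    have huv : ¬ Commute u v := fun hc ↦ hne (by
      rw [Set.mem_singleton_iff, normCent, normCent, h.cent_eq hu1 hv1 hc])
    have hv'1 : u * v * u⁻¹ ≠ 1 := conj_eq_one.not.2 hv1
    have hv' : (u * v * u⁻¹) * (u * v * u⁻¹) = 1 := conj_mul_self.2 hv
    have hvv' : ¬ Commute v (u * v * u⁻¹) := fun hc ↦ huv
      (h.commute_of_sq_of_mem_normCent hv1 hv hu ((h.mem_normCent hv1).2 hc)).symm
    obtain ⟨y, hy1, hyv, hyv'⟩ := h.exists_mem_inf hq hq4 hv1 hv hv'1 hv'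
    have hy := h.mul_self_ne_of_mem_inf hv1 hv hv'1 hv' hvv' hy1 hyv hyv'
    have hinf := h.inf_eq_cent hq hq4 hv1 hv hv'1 hv' hvv' hy1 hyv hyv'
    have hconj {z : G} : u * z * u⁻¹ ∈ normCent v ↔ z ∈ normCent (u * v * u⁻¹) := by
      rw [← conj_mem_normCent (a := u) (u := v)]
      have : u * (u * z * u⁻¹) * u⁻¹ = z := by
        calc u * (u * z * u⁻¹) * u⁻¹ = (u * u) * z * (u * u)⁻¹ := by group
          _ = z := by rw [hu]; group
      rw [this]
    have huy : u ∈ normCent y := by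
      rw [h.mem_normCent hy1, ← mem_cent, ← hinf]
      refine ⟨hconj.2 hyv', ?_⟩
      exact conj_mem_normCent.2 hyv
    rw [Finset.card_eq_one]
    refine ⟨normCent y, ?_⟩
    ext D
    simp only [Finset.mem_bipartiteAbove, t, Set.Finite.mem_toFinset, Finset.mem_singleton]
    constructor
    · rintro ⟨⟨z', -, -, hDz', huz⟩, z, hz, rfl, hzv⟩
      have hinv := h.inverts_of_mem_normCent hu1 hu hz huz
      have : z ∈ normCent v ⊓ normCent (u * v * u⁻¹) :=
        ⟨hzv, hconj.1 (by rw [hinv]; exact (normCent v).inv_mem hzv)⟩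
      rw [hinf] at this
      rw [h.normCent_eq_iff hz hy]
      exact (mem_cent.1 this).symm
    · rintro rfl
      exact ⟨⟨y, hy, h.card_cent_of_mem_normCent hq hq4 hv1 hv hy hyv, rfl, huy⟩, y, hy, rfl, hyv⟩
  -- Both Borel subgroups containing the torus differ from that of u, since u inverts the torus.
  have h2 : ∀ D ∈ t, (s.bipartiteBelow r D).card = 2 := by
    intro D hD
    simp only [t, Set.Finite.mem_toFinset] at hD
    obtain ⟨y, hy, hyc, rfl, huy⟩ := hD
    rw [← h.ncard_borels_of_card_eq hq hq4 hy hyc, Set.ncard_eq_toFinset_card (borels y)]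
    congr 1
    ext M
    simp only [Finset.mem_bipartiteBelow, s, Set.Finite.mem_toFinset]
    constructor
    · rintro ⟨⟨⟨v, hv1, hv, rfl, -⟩, -⟩, z, hz, hDz, hzv⟩
      exact ⟨v, hv1, hv, rfl, h.cent_le_normCent_of_sq hq (by omega) hv1 hv hz hzv
        ((h.normCent_eq_iff hy hz).1 hDz).symm⟩
    · rintro ⟨v, hv1, hv, rfl, hyv⟩
      refine ⟨⟨⟨v, hv1, hv, rfl, Subgroup.one_mem _⟩, fun hc ↦ ?_⟩, y, hy, rfl, hyv⟩
      rw [Set.mem_singleton_iff] at hc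
      rw [hc] at hyv
      exact h.not_inverts_of_mem_normCent hu1 hu hy hyv (h.inverts_of_mem_normCent hu1 hu hy huy)
  have := Finset.card_mul_eq_card_mul r h1 h2
  rw [hs, ht] at this
  omega

/-- An element x is inverted by u exactly when ux has square 1, and then x² ≠ 1 means that ux does
not commute with u. So the count is q² - q. -/
theorem ncard_inverted [Finite G] {u : G} (hu1 : u ≠ 1) (hu : u * u = 1) :
    {x : G | x * x ≠ 1 ∧ u * x * u⁻¹ = x⁻¹}.ncard = q * (q - 1) := by
  have hu' : u⁻¹ = u := inv_eq_of_mul_eq_one_left hu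
  have huu (x : G) : u * (u * x) = x := by rw [← mul_assoc, hu, one_mul]
  have e1 : {x : G | x * x ≠ 1 ∧ u * x * u⁻¹ = x⁻¹} =
      (fun w ↦ u * w) '' ({w : G | w * w = 1} \ (cent u : Set G)) := by
    have key (x : G) : u * x * u⁻¹ = x⁻¹ ↔ (u * x) * (u * x) = 1 := by
      rw [hu', ← mul_eq_one_iff_eq_inv, mul_assoc (u * x)]
    ext x
    rw [Set.mem_ofPred_eq, key]
    constructor
    · rintro ⟨hx, hux⟩
      refine ⟨u * x, ⟨hux, fun hc ↦ hx ?_⟩, huu x⟩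
      have hc : Commute u x := by
        have := (Commute.refl u).mul_right (mem_cent.1 hc)
        rwa [huu] at this
      rw [mul_assoc, ← mul_assoc x, ← hc.eq, mul_assoc u, huu] at hux
      exact hux
    · rintro ⟨w, ⟨hw, hwu⟩, rfl⟩
      refine ⟨fun hc ↦ hwu (mem_cent.2 ?_), by rw [huu]; exact hw⟩
      have := inv_eq_of_mul_eq_one_left hc
      rw [mul_inv_rev, hu', inv_eq_of_mul_eq_one_left hw] at this
      exact this.symm
  have hsub : (cent u : Set G) ⊆ {w : G | w * w = 1} :=
    fun w hw ↦ h.sq_of_comm u w hu1 hu (mem_cent.1 hw)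
  rw [e1, Set.ncard_image_of_injective _ (mul_right_injective u), Set.ncard_sdiff hsub]
  have h1 : {w : G | w * w = 1}.ncard = q ^ 2 := h.card_sq
  have h2 : (cent u : Set G).ncard = q := h.card_of_sq u hu1 hu
  rw [h1, h2, Nat.mul_sub, mul_one, pow_two]

theorem torusNormalizers_pairwiseDisjoint (s : Set (Subgroup G))
    (hs : ∀ M ∈ s, ∃ y, y * y ≠ 1 ∧ M = normCent y) :
    s.PairwiseDisjoint (fun M ↦ {x : G | x ∈ M ∧ x * x ≠ 1}) := by
  intro M hM N hN hMN
  obtain ⟨y, hy, rfl⟩ := hs M hM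
  obtain ⟨z, hz, rfl⟩ := hs N hN
  rw [Function.onFun, Set.disjoint_left]
  rintro x ⟨hxy, hx⟩ ⟨hxz, -⟩
  apply hMN
  rw [h.normCent_eq_iff hy hz]
  exact h.comm_trans x y z (ne_one_of_mul_self_ne hx) (h.commute_of_mem_normCent hy hx hxy).symm
    (h.commute_of_mem_normCent hz hx hxz).symm

theorem ncard_torus_part {y : G} (hy : y * y ≠ 1) :
    {x : G | x ∈ normCent y ∧ x * x ≠ 1}.ncard = Nat.card (cent y) - 1 := by
  have : {x : G | x ∈ normCent y ∧ x * x ≠ 1} = (cent y : Set G) \ {1} := by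
    ext x
    constructor
    · rintro ⟨hxy, hx⟩
      exact ⟨mem_cent.2 (h.commute_of_mem_normCent hy hx hxy), ne_one_of_mul_self_ne hx⟩
    · rintro ⟨hxy, hx⟩
      exact ⟨cent_le_normCent y hxy, h.mul_self_ne_of_commute hy hx (mem_cent.1 hxy)⟩
  rw [this, Set.ncard_sdiff_singleton_of_mem (Subgroup.one_mem _)]
  rfl

/-- The q(q - 1) elements with non-trivial square inverted by u are distributed over the tori that u
inverts. The q/2 tori of order q - 1 account for (q/2)(q - 2) of them; each torus of order q + 1
takes q of the rest. -/
theorem ncard_torusNormalizers_add [Finite G] (hq : Even q) (hq4 : 4 ≤ q) {u : G} (hu1 : u ≠ 1)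
    (hu : u * u = 1) : (torusNormalizers (q + 1) u).ncard = q / 2 := by
  have hsub (n : ℕ) : ∀ M ∈ torusNormalizers n u, ∃ y, y * y ≠ 1 ∧ M = normCent y := by
    rintro M ⟨y, hy, -, rfl, -⟩
    exact ⟨y, hy, rfl⟩
  have hcard (n : ℕ) : (⋃ M ∈ torusNormalizers n u, {x : G | x ∈ M ∧ x * x ≠ 1}).ncard =
      (torusNormalizers n u).ncard * (n - 1) := by
    refine ncard_biUnion_const (h.torusNormalizers_pairwiseDisjoint _ (hsub n)) ?_
    rintro M ⟨y, hy, rfl, rfl, -⟩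
    exact h.ncard_torus_part hy
  have hunion : {x : G | x * x ≠ 1 ∧ u * x * u⁻¹ = x⁻¹} =
      (⋃ M ∈ torusNormalizers (q - 1) u, {x : G | x ∈ M ∧ x * x ≠ 1}) ∪
      (⋃ M ∈ torusNormalizers (q + 1) u, {x : G | x ∈ M ∧ x * x ≠ 1}) := by
    ext x
    simp only [Set.mem_union, Set.mem_iUnion, Set.mem_ofPred_eq]
    constructor
    · rintro ⟨hx, hux⟩
      have h1 := h.mem_normCent_of_inverts hx hux
      have h2 := cent_le_normCent x (mem_cent.2 (Commute.refl x))
      rcases h.card_of_not_sq x hx with hc | hc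
      · exact Or.inl ⟨normCent x, ⟨x, hx, hc, rfl, h1⟩, h2, hx⟩
      · exact Or.inr ⟨normCent x, ⟨x, hx, hc, rfl, h1⟩, h2, hx⟩
    · rintro (⟨M, ⟨y, hy, -, rfl, huy⟩, hxy, hx⟩ | ⟨M, ⟨y, hy, -, rfl, huy⟩, hxy, hx⟩) <;>
      exact ⟨hx, h.inverts_of_commute hy (h.inverts_of_mem_normCent hu1 hu hy huy)
        (h.commute_of_mem_normCent hy hx hxy)⟩
  have hdisj : Disjoint (⋃ M ∈ torusNormalizers (q - 1) u, {x : G | x ∈ M ∧ x * x ≠ 1})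
      (⋃ M ∈ torusNormalizers (q + 1) u, {x : G | x ∈ M ∧ x * x ≠ 1}) := by
    rw [Set.disjoint_left]
    simp only [Set.mem_iUnion, Set.mem_ofPred_eq]
    rintro x ⟨M, ⟨y, hy, hyc, rfl, -⟩, hxy, hx⟩ ⟨N, ⟨z, hz, hzc, rfl, -⟩, hxz, -⟩
    have h1 := h.cent_eq (ne_one_of_mul_self_ne hy) (ne_one_of_mul_self_ne hx)
      (h.commute_of_mem_normCent hy hx hxy)
    have h2 := h.cent_eq (ne_one_of_mul_self_ne hz) (ne_one_of_mul_self_ne hx)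
      (h.commute_of_mem_normCent hz hx hxz)
    rw [h1, ← h2, hzc] at hyc
    omega
  have key := h.ncard_inverted hu1 hu
  rw [hunion, Set.ncard_union_eq hdisj, hcard, hcard, h.ncard_torusNormalizers_sub hq hq4 hu1 hu,
    Nat.add_sub_cancel] at key
  obtain ⟨m, rfl⟩ := hq
  have e1 : (m + m) / 2 = m := by omega
  obtain ⟨k, rfl⟩ : ∃ k, m = k + 1 := ⟨m - 1, by omega⟩
  have e2 : k + 1 + (k + 1) - 1 - 1 = 2 * k := by omega
  have e3 : k + 1 + (k + 1) - 1 = 2 * k + 1 := by omega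
  rw [e1, e2, e3] at key
  rw [e1]
  nlinarith

end IsEvenSL2
-- Types of maximal subgroups, their intersections, and sizes of solubilizers
theorem isCyclicType_of_isCyclic {H : Type*} [Group H] {n : ℕ} (hH : IsCyclic H)
    (hn : Nat.card H = n) : Solubilizer.IsCyclicType n H :=
  ⟨(hn ▸ zmodCyclicMulEquiv hH).symm⟩

theorem orderOf_dvd_card_cent {G : Type*} [Group G] (x : G) : orderOf x ∣ Nat.card (cent x) := by
  rw [← Subgroup.orderOf_mk x (mem_cent.2 (Commute.refl x))]
  exact orderOf_dvd_natCard _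

theorem eq_one_of_orderOf_dvd {G : Type*} [Group G] {q : ℕ} (hq : Even q) (hq0 : q ≠ 0) {x : G} (h1 : orderOf x ∣ q - 1)
    (h2 : orderOf x ∣ q + 1) : x = 1 := by
  rw [← orderOf_eq_one_iff]
  have h3 : orderOf x ∣ 2 := by
    have := (Nat.dvd_sub h2 h1)
    rwa [show q + 1 - (q - 1) = 2 by omega] at this
  have hodd : Odd (orderOf x) := hq.add_one.of_dvd_nat h2
  exact Nat.Coprime.eq_one_of_dvd hodd.coprime_two_right h3

/-- Orders alone separate the Borel type from both dihedral types, so each isomorphism type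
identifies the kind of normalizer. -/
theorem borel_card_ne {q : ℕ} (hq4 : 4 ≤ q) :
    (q - 1) * q ≠ 2 * (q - 1) ∧ (q - 1) * q ≠ 2 * (q + 1) := by
  obtain ⟨m, rfl⟩ : ∃ m, q = m + 4 := ⟨q - 4, by omega⟩
  have e1 : m + 4 - 1 = m + 3 := by omega
  rw [e1]
  constructor <;> nlinarith

namespace IsEvenSL2

variable {G : Type*} [Group G] {q : ℕ} (h : IsEvenSL2 q G)

include h

theorem setOf_isBorelType [Finite G] {p : ℕ} (hp : p.Prime) (hqp : q = 2 ^ p) (hq : Even q)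
    (hq4 : 4 ≤ q) (x : G) :
    {M ∈ Solubilizer.maximalContaining x | Solubilizer.IsBorelType p M} = borels x := by
  ext M
  constructor
  · rintro ⟨⟨hM, hxM⟩, hB⟩
    obtain ⟨z, hz1, rfl⟩ := (h.isCoatom_iff hp hqp (by omega)).1 hM
    refine ⟨z, hz1, ?_, rfl, hxM⟩
    by_contra hz
    have h1 := card_of_isBorelType hB
    rw [← hqp, h.card_normCent hz] at h1
    have := borel_card_ne hq4
    rcases h.card_of_not_sq z hz with hc | hc <;> rw [hc] at h1 <;> omega
  · rintro ⟨u, hu1, hu, rfl, hxu⟩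
    exact ⟨⟨(h.isCoatom_iff hp hqp (by omega)).2 ⟨u, hu1, rfl⟩, hxu⟩,
      h.isBorelType hqp hq hq4 hu1 hu⟩

theorem setOf_isDihedralType [Finite G] {p : ℕ} (hp : p.Prime) (hqp : q = 2 ^ p) (hq : Even q)
    (hq4 : 4 ≤ q) (x : G) {n : ℕ} (hn : n = q - 1 ∨ n = q + 1) :
    {M ∈ Solubilizer.maximalContaining x | Solubilizer.IsDihedralType n M} =
      torusNormalizers n x := by
  ext M
  constructor
  · rintro ⟨⟨hM, hxM⟩, hD⟩
    obtain ⟨z, hz1, rfl⟩ := (h.isCoatom_iff hp hqp (by omega)).1 hM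
    have h1 := card_of_isDihedralType hD
    have hz : z * z ≠ 1 := by
      intro hz
      rw [h.card_normCent_of_sq hq (by omega) hz1 hz] at h1
      have := borel_card_ne hq4
      rcases hn with rfl | rfl <;> omega
    rw [h.card_normCent hz] at h1
    exact ⟨z, hz, by omega, rfl, hxM⟩
  · rintro ⟨y, hy, rfl, rfl, hxy⟩
    exact ⟨⟨(h.isCoatom_iff hp hqp (by omega)).2 ⟨y, ne_one_of_mul_self_ne hy, rfl⟩, hxy⟩,
      h.isDihedralType hy⟩

theorem maximalContaining_eq [Finite G] {p : ℕ} (hp : p.Prime) (hqp : q = 2 ^ p)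
    (hq4 : 4 ≤ q) (x : G) : Solubilizer.maximalContaining x =
      borels x ∪ (torusNormalizers (q - 1) x ∪ torusNormalizers (q + 1) x) := by
  ext M
  constructor
  · rintro ⟨hM, hxM⟩
    obtain ⟨z, hz1, rfl⟩ := (h.isCoatom_iff hp hqp (by omega)).1 hM
    by_cases hz : z * z = 1
    · exact Or.inl ⟨z, hz1, hz, rfl, hxM⟩
    · rcases h.card_of_not_sq z hz with hc | hc
      · exact Or.inr (Or.inl ⟨z, hz, hc, rfl, hxM⟩)
      · exact Or.inr (Or.inr ⟨z, hz, hc, rfl, hxM⟩)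
  · rintro (⟨z, hz1, -, rfl, hxM⟩ | ⟨z, hz, -, rfl, hxM⟩ | ⟨z, hz, -, rfl, hxM⟩)
    · exact ⟨(h.isCoatom_iff hp hqp (by omega)).2 ⟨z, hz1, rfl⟩, hxM⟩
    · exact ⟨(h.isCoatom_iff hp hqp (by omega)).2 ⟨z, ne_one_of_mul_self_ne hz, rfl⟩, hxM⟩
    · exact ⟨(h.isCoatom_iff hp hqp (by omega)).2 ⟨z, ne_one_of_mul_self_ne hz, rfl⟩, hxM⟩

theorem torusNormalizers_eq {x : G} (hx : x * x ≠ 1) :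
    torusNormalizers (Nat.card (cent x)) x = {normCent x} := by
  ext M
  constructor
  · rintro ⟨y, hy, -, rfl, hxy⟩
    exact (h.normCent_eq_iff hy hx).2 (h.commute_of_mem_normCent hy hx hxy)
  · rintro rfl
    exact ⟨x, hx, rfl, rfl, cent_le_normCent x (mem_cent.2 (Commute.refl x))⟩

theorem torusNormalizers_eq_empty {x : G} (hx : x * x ≠ 1) {n : ℕ} (hn : Nat.card (cent x) ≠ n) :
    torusNormalizers n x = ∅ := by
  rw [Set.eq_empty_iff_forall_notMem]
  rintro M ⟨y, hy, rfl, rfl, hxy⟩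
  refine hn ?_
  rw [h.cent_eq (ne_one_of_mul_self_ne hx) (ne_one_of_mul_self_ne hy)
    (h.commute_of_mem_normCent hy hx hxy).symm]

theorem borels_eq_empty [Finite G] (hq : Even q) (hq4 : 4 ≤ q) {x : G} (hx : x * x ≠ 1)
    (hxc : Nat.card (cent x) = q + 1) : borels x = ∅ := by
  rw [Set.eq_empty_iff_forall_notMem]
  rintro M ⟨u, hu1, hu, rfl, hxu⟩
  have := h.card_cent_of_mem_normCent hq hq4 hu1 hu hx hxu
  omega

theorem orderOf_cases (hq : Even q) (hq0 : q ≠ 0) {x : G} (hx1 : x ≠ 1) :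
    (x * x = 1 ∧ orderOf x = 2 ∧ ¬ orderOf x ∣ q - 1 ∧ ¬ orderOf x ∣ q + 1) ∨
    (x * x ≠ 1 ∧ Nat.card (cent x) = q - 1 ∧ orderOf x ≠ 2 ∧ orderOf x ∣ q - 1 ∧
      ¬ orderOf x ∣ q + 1) ∨
    (x * x ≠ 1 ∧ Nat.card (cent x) = q + 1 ∧ orderOf x ≠ 2 ∧ ¬ orderOf x ∣ q - 1 ∧
      orderOf x ∣ q + 1) := by
  by_cases hx : x * x = 1
  · have h2 : orderOf x = 2 := orderOf_eq_prime (by rw [pow_two, hx]) hx1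
    refine Or.inl ⟨hx, h2, ?_, ?_⟩ <;> rw [h2, ← even_iff_two_dvd, Nat.not_even_iff_odd]
    · exact Nat.Even.sub_odd (by omega) hq odd_one
    · exact hq.add_one
  · have h2 : orderOf x ≠ 2 := fun e ↦ hx (by rw [← pow_two, ← e, pow_orderOf_eq_one])
    have hd := orderOf_dvd_card_cent x
    rcases h.card_of_not_sq x hx with hc | hc <;> rw [hc] at hd
    · exact Or.inr (Or.inl ⟨hx, hc, h2, hd, fun h3 ↦ hx1 (eq_one_of_orderOf_dvd hq hq0 hd h3)⟩)
    · exact Or.inr (Or.inr ⟨hx, hc, h2, fun h3 ↦ hx1 (eq_one_of_orderOf_dvd hq hq0 h3 hd), hd⟩)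

/-- Suppose z is neither 1 nor u. If z is an involution, uz centralizes y, and it either centralizes
x as well, making the normalizers equal, or has square 1. If z² ≠ 1, then z lies in the torus of y;
either it also lies in the torus of x, or u inverts an element of its own Borel subgroup. Each
outcome is impossible. -/
theorem mem_pair_of_mem_normCent {u y z : G} (hu1 : u ≠ 1) (hu : u * u = 1)
    {M : Subgroup G} (hM : ∃ x, x ≠ 1 ∧ M = normCent x) (huM : u ∈ M) (hy : y * y ≠ 1)
    (huy : u ∈ normCent y) (hne : M ≠ normCent y) (hzM : z ∈ M) (hzy : z ∈ normCent y) :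
    z = 1 ∨ z = u := by
  obtain ⟨x, hx1, rfl⟩ := hM
  have hu' : u⁻¹ = u := inv_eq_of_mul_eq_one_left hu
  have hinv := h.inverts_of_mem_normCent hu1 hu hy huy
  by_contra! hc
  obtain ⟨hz1, hzu⟩ := hc
  have huz1 : u * z ≠ 1 := fun e ↦ hzu (by rw [← inv_eq_of_mul_eq_one_right e, hu'])
  have huzC (w : G) (hw : w * w ≠ 1) (huw : u ∈ normCent w) (hzw : z ∈ normCent w)
      (hz : z * z = 1) : Commute w (u * z) := by
    have i1 := h.inverts_of_mem_normCent hu1 hu hw huw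
    have i2 := h.inverts_of_mem_normCent hz1 hz hw hzw
    have : u * z * w * (u * z)⁻¹ = w := by
      calc u * z * w * (u * z)⁻¹ = u * (z * w * z⁻¹) * u⁻¹ := by group
        _ = (u * w * u⁻¹)⁻¹ := by rw [i2]; group
        _ = w := by rw [i1, inv_inv]
    exact (mul_inv_eq_iff_eq_mul.1 this).symm
  by_cases hz : z * z = 1
  · have hyuz := huzC y hy huy hzy hz
    have huz := h.mul_self_ne_of_commute hy huz1 hyuz
    by_cases hx : x * x = 1
    · have c1 := h.commute_of_sq_of_mem_normCent hx1 hx hu huM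
      have c2 := h.commute_of_sq_of_mem_normCent hx1 hx hz hzM
      exact huz (h.sq_of_comm x _ hx1 hx (c1.mul_right c2))
    · have hxuz := huzC x hx huM hzM hz
      exact hne ((h.normCent_eq_iff hx hy).2 (h.comm_trans _ _ _ huz1 hxuz.symm hyuz.symm))
  · have hyz := h.commute_of_mem_normCent hy hz hzy
    by_cases hx : x * x = 1
    · have c1 := h.commute_of_sq_of_mem_normCent hx1 hx hu huM
      have : z ∈ normCent u := by
        rw [normCent, ← h.cent_eq hx1 hu1 c1]
        exact hzM
      exact h.not_inverts_of_mem_normCent hu1 hu hz this (h.inverts_of_commute hy hinv hyz)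
    · have hxz := h.commute_of_mem_normCent hx hz hzM
      exact hne ((h.normCent_eq_iff hx hy).2 (h.comm_trans _ _ _ hz1 hxz.symm hyz.symm))

theorem inf_eq_pair [Finite G] {p : ℕ} (hp : p.Prime) (hqp : q = 2 ^ p) (hq4 : 4 ≤ q) {u : G}
    (hu1 : u ≠ 1) (hu : u * u = 1) {M N : Subgroup G} (hM : M ∈ Solubilizer.maximalContaining u)
    (hN : N ∈ Solubilizer.maximalContaining u) (hMN : M ≠ N) :
    ((M ⊓ N : Subgroup G) : Set G) = {1, u} := by
  have hle {M N : Subgroup G} (hM : M ∈ Solubilizer.maximalContaining u)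
      (hN : N ∈ torusNormalizers (q - 1) u ∪ torusNormalizers (q + 1) u) (hMN : M ≠ N) :
      ((M ⊓ N : Subgroup G) : Set G) ⊆ {1, u} := by
    rintro z ⟨hzM, hzN⟩
    have hM' := (h.isCoatom_iff hp hqp (by omega)).1 hM.1
    rcases hN with ⟨y, hy, -, rfl, huy⟩ | ⟨y, hy, -, rfl, huy⟩ <;>
    exact h.mem_pair_of_mem_normCent hu1 hu hM' hM.2 hy huy hMN hzM hzN
  apply Set.Subset.antisymm
  · have hM' := h.maximalContaining_eq hp hqp hq4 u ▸ hM
    have hN' := h.maximalContaining_eq hp hqp hq4 u ▸ hN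
    rcases hN' with hN' | hN'
    · rcases hM' with hM' | hM'
      · rw [h.borels_eq_singleton hu1 hu] at hM' hN'
        exact absurd (hM'.trans hN'.symm) hMN
      · rw [inf_comm]
        exact hle hN hM' hMN.symm
    · exact hle hM hN' hMN
  · rintro z (rfl | rfl)
    · exact Subgroup.one_mem _
    · exact ⟨hM.2, hN.2⟩

theorem isCyclicType_two [Finite G] {p : ℕ} (hp : p.Prime) (hqp : q = 2 ^ p) (hq4 : 4 ≤ q) {u : G}
    (hu1 : u ≠ 1) (hu : u * u = 1) {M N : Subgroup G} (hM : M ∈ Solubilizer.maximalContaining u)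
    (hN : N ∈ Solubilizer.maximalContaining u) (hMN : M ≠ N) :
    Solubilizer.IsCyclicType 2 ↥(M ⊓ N) := by
  have hc : Nat.card ↥(M ⊓ N) = 2 := by
    have := h.inf_eq_pair hp hqp hq4 hu1 hu hM hN hMN
    change ((M ⊓ N : Subgroup G) : Set G).ncard = 2
    rw [this, Set.ncard_pair hu1.symm]
  have : Fact (Nat.Prime 2) := ⟨Nat.prime_two⟩
  exact isCyclicType_of_isCyclic (isCyclic_of_prime_card hc) hc

/-- The maximal subgroups containing u are disjoint outside the core {1, u}. The total is 2 + (q(q -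
1) - 2) + (q/2)(2(q - 1) - 2) + (q/2)(2(q + 1) - 2). -/
theorem ncard_solubilizer_involution [Finite G] {p : ℕ} (hp : p.Prime) (hqp : q = 2 ^ p)
    (hq : Even q) (hq4 : 4 ≤ q) {u : G} (hu1 : u ≠ 1) (hu : u * u = 1) :
    (Solubilizer.solubilizer u).ncard = 3 * q * (q - 1) := by
  set P : Set G := {1, u} with hP
  have hP2 : P.ncard = 2 := Set.ncard_pair hu1.symm
  have hmax := h.maximalContaining_eq hp hqp hq4 u
  have hPM {M : Subgroup G} (hM : u ∈ M) : P ⊆ (M : Set G) := by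
    rintro z (rfl | rfl)
    · exact M.one_mem
    · exact hM
  have hdis : (Solubilizer.maximalContaining u).PairwiseDisjoint
      (fun M : Subgroup G ↦ (M : Set G) \ P) := by
    intro M hM N hN hMN
    rw [Function.onFun, Set.disjoint_left]
    rintro z ⟨hzM, hzP⟩ ⟨hzN, -⟩
    apply hzP
    rw [hP, ← h.inf_eq_pair hp hqp hq4 hu1 hu hM hN hMN]
    exact ⟨hzM, hzN⟩
  have hsplit : Solubilizer.solubilizer u = P ∪ ((⋃ M ∈ borels u, (M : Set G) \ P) ∪
      ((⋃ M ∈ torusNormalizers (q - 1) u, (M : Set G) \ P) ∪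
        (⋃ M ∈ torusNormalizers (q + 1) u, (M : Set G) \ P))) := by
    rw [h.solubilizer_eq hp hqp hq hq4, ← Set.biUnion_union, ← Set.biUnion_union, ← hmax]
    ext z
    simp only [Set.mem_iUnion, Set.mem_union, Set.mem_sdiff, exists_prop]
    constructor
    · rintro ⟨M, hM, hz⟩
      by_cases hzP : z ∈ P
      · exact Or.inl hzP
      · exact Or.inr ⟨M, hM, hz, hzP⟩
    · rintro (hz | ⟨M, hM, hz, -⟩)
      · refine ⟨normCent u, ?_, hPM (cent_le_normCent u (mem_cent.2 (Commute.refl u))) hz⟩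
        rw [hmax, h.borels_eq_singleton hu1 hu]
        exact Or.inl rfl
      · exact ⟨M, hM, hz⟩
  have hsub1 : borels u ⊆ Solubilizer.maximalContaining u := hmax ▸ Set.subset_union_left
  have hsub2 : torusNormalizers (q - 1) u ⊆ Solubilizer.maximalContaining u :=
    hmax ▸ Set.subset_union_left.trans Set.subset_union_right
  have hsub3 : torusNormalizers (q + 1) u ⊆ Solubilizer.maximalContaining u :=
    hmax ▸ Set.subset_union_right.trans Set.subset_union_right
  have c1 : (⋃ M ∈ borels u, (M : Set G) \ P).ncard = 1 * ((q - 1) * q - 2) := by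
    rw [ncard_biUnion_const (hdis.subset hsub1) (m := (q - 1) * q - 2), h.borels_eq_singleton hu1 hu,
      Set.ncard_singleton]
    rintro M ⟨v, hv1, hv, rfl, huv⟩
    rw [Set.ncard_sdiff (hPM huv), hP2, ← h.card_normCent_of_sq hq (by omega) hv1 hv]
    rfl
  have ct (n : ℕ) (hsub : torusNormalizers n u ⊆ Solubilizer.maximalContaining u) :
      (⋃ M ∈ torusNormalizers n u, (M : Set G) \ P).ncard =
        (torusNormalizers n u).ncard * (2 * n - 2) := by
    rw [ncard_biUnion_const (hdis.subset hsub) (m := 2 * n - 2)]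
    rintro M ⟨y, hy, rfl, rfl, huy⟩
    rw [Set.ncard_sdiff (hPM huy), hP2, ← h.card_normCent hy]
    rfl
  have hd {A B : Set (Subgroup G)} (hA : A ⊆ Solubilizer.maximalContaining u)
      (hB : B ⊆ Solubilizer.maximalContaining u) (hAB : ∀ M ∈ A, M ∉ B) :
      Disjoint (⋃ M ∈ A, (M : Set G) \ P) (⋃ M ∈ B, (M : Set G) \ P) := by
    simp only [Set.disjoint_iUnion_left, Set.disjoint_iUnion_right]
    intro M hM N hN
    exact hdis (hA hN) (hB hM) fun e ↦ hAB N hN (e ▸ hM)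
  have hd2 : Disjoint (⋃ M ∈ torusNormalizers (q - 1) u, (M : Set G) \ P)
      (⋃ M ∈ torusNormalizers (q + 1) u, (M : Set G) \ P) := by
    refine hd hsub2 hsub3 ?_
    rintro M ⟨y, hy, hyc, rfl, -⟩ ⟨z, hz, hzc, hyz, -⟩
    rw [h.cent_eq (ne_one_of_mul_self_ne hy) (ne_one_of_mul_self_ne hz)
      ((h.normCent_eq_iff hy hz).1 hyz), hzc] at hyc
    omega
  have hd1 : Disjoint (⋃ M ∈ borels u, (M : Set G) \ P)
      ((⋃ M ∈ torusNormalizers (q - 1) u, (M : Set G) \ P) ∪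
        (⋃ M ∈ torusNormalizers (q + 1) u, (M : Set G) \ P)) := by
    rw [← Set.biUnion_union]
    refine hd hsub1 (Set.union_subset hsub2 hsub3) ?_
    rintro M ⟨v, hv1, hv, rfl, -⟩ (⟨z, hz, -, hvz, -⟩ | ⟨z, hz, -, hvz, -⟩) <;>
    exact h.mul_self_ne_of_commute hz hv1 (mem_cent.1
      ((h.cent_inj_of_normCent_eq (by omega) hv1 (ne_one_of_mul_self_ne hz)).1 hvz ▸
        mem_cent.2 (Commute.refl v))) hv
  have hd0 : Disjoint P ((⋃ M ∈ borels u, (M : Set G) \ P) ∪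
      ((⋃ M ∈ torusNormalizers (q - 1) u, (M : Set G) \ P) ∪
        (⋃ M ∈ torusNormalizers (q + 1) u, (M : Set G) \ P))) := by
    rw [← Set.biUnion_union, ← Set.biUnion_union]
    simp only [Set.disjoint_iUnion_right]
    exact fun _ _ ↦ Set.disjoint_sdiff_right
  rw [hsplit, Set.ncard_union_eq hd0, Set.ncard_union_eq hd1, Set.ncard_union_eq hd2, hP2, c1,
    ct _ hsub2, ct _ hsub3, h.ncard_torusNormalizers_sub hq hq4 hu1 hu,
    h.ncard_torusNormalizers_add hq hq4 hu1 hu]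
  obtain ⟨m, rfl⟩ := hq
  obtain ⟨k, rfl⟩ : ∃ k, m = k + 2 := ⟨m - 2, by omega⟩
  have e1 : (k + 2 + (k + 2)) / 2 = k + 2 := by omega
  have e2 : k + 2 + (k + 2) - 1 = 2 * k + 3 := by omega
  have e3 : 2 * (2 * k + 3) - 2 = 4 * k + 4 := by omega
  have e4 : 2 * (k + 2 + (k + 2) + 1) - 2 = 4 * k + 8 := by omega
  have e5 : (2 * k + 3) * (k + 2 + (k + 2)) - 2 = 4 * k ^ 2 + 14 * k + 10 := by
    apply Nat.sub_eq_of_eq_add; ring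
  rw [e1, e2, e3, e4, e5]
  ring

theorem inf_eq_cent_of_card_eq [Finite G] {p : ℕ} (hp : p.Prime) (hqp : q = 2 ^ p)
    (hq : Even q) (hq4 : 4 ≤ q) {x : G} (hx : x * x ≠ 1) (hxc : Nat.card (cent x) = q - 1)
    {M N : Subgroup G} (hM : M ∈ Solubilizer.maximalContaining x)
    (hN : N ∈ Solubilizer.maximalContaining x) (hMN : M ≠ N) : M ⊓ N = cent x := by
  have hx1 := ne_one_of_mul_self_ne hx
  have hmax : Solubilizer.maximalContaining x = borels x ∪ {normCent x} := by
    rw [h.maximalContaining_eq hp hqp hq4, h.torusNormalizers_eq_empty hx (n := q + 1) (by omega),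
      ← hxc, h.torusNormalizers_eq hx, Set.union_empty]
  have key {N : Subgroup G} (hN : N ∈ borels x) : normCent x ⊓ N = cent x := by
    obtain ⟨u, hu1, hu, rfl, hxu⟩ := hN
    apply le_antisymm
    · rintro z ⟨hzx, hzu⟩
      by_cases hz1 : z = 1
      · exact hz1 ▸ Subgroup.one_mem _
      by_cases hz : z * z = 1
      · have huz := h.commute_of_sq_of_mem_normCent hu1 hu hz hzu
        refine absurd (h.inverts_of_mem_normCent hz1 hz hx hzx)
          (h.not_inverts_of_mem_normCent hz1 hz hx ?_)
        rw [normCent, ← h.cent_eq hu1 hz1 huz]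
        exact hxu
      · exact mem_cent.2 (h.commute_of_mem_normCent hx hz hzx)
    · exact fun z hz ↦ ⟨cent_le_normCent x hz,
        h.cent_le_normCent_of_sq hq (by omega) hu1 hu hx hxu (mem_cent.1 hz)⟩
  rw [hmax] at hM hN
  rcases hM with hM | rfl
  · rcases hN with hN | rfl
    · obtain ⟨u, hu1, hu, rfl, hxu⟩ := hM
      obtain ⟨v, hv1, hv, rfl, hxv⟩ := hN
      refine h.inf_eq_cent hq hq4 hu1 hu hv1 hv (fun hc ↦ hMN ?_) hx1 hxu hxv
      rw [normCent, h.cent_eq hu1 hv1 hc]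
    · rw [inf_comm]
      exact key hM
  · rcases hN with hN | rfl
    · exact key hN
    · exact absurd rfl hMN

/-- The core is now the torus of x. The dihedral group contributes 2(q - 1) elements, and each of
the two Borel subgroups a further (q - 1)q - (q - 1). -/
theorem ncard_solubilizer_sub [Finite G] {p : ℕ} (hp : p.Prime) (hqp : q = 2 ^ p)
    (hq : Even q) (hq4 : 4 ≤ q) {x : G} (hx : x * x ≠ 1) (hxc : Nat.card (cent x) = q - 1) :
    (Solubilizer.solubilizer x).ncard = 2 * q * (q - 1) := by
  have hx1 := ne_one_of_mul_self_ne hx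
  have hmax : Solubilizer.maximalContaining x = borels x ∪ {normCent x} := by
    rw [h.maximalContaining_eq hp hqp hq4, h.torusNormalizers_eq_empty hx (n := q + 1) (by omega),
      ← hxc, h.torusNormalizers_eq hx, Set.union_empty]
  have hC : (cent x : Set G).ncard = q - 1 := hxc
  have hle {M : Subgroup G} (hM : M ∈ Solubilizer.maximalContaining x) :
      (cent x : Set G) ⊆ M := by
    rw [hmax] at hM
    rcases hM with ⟨u, hu1, hu, rfl, hxu⟩ | rfl
    · exact fun z hz ↦ h.cent_le_normCent_of_sq hq (by omega) hu1 hu hx hxu (mem_cent.1 hz)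
    · exact cent_le_normCent x
  have hdis : (Solubilizer.maximalContaining x).PairwiseDisjoint
      (fun M : Subgroup G ↦ (M : Set G) \ (cent x : Set G)) := by
    intro M hM N hN hMN
    rw [Function.onFun, Set.disjoint_left]
    rintro z ⟨hzM, hzP⟩ ⟨hzN, -⟩
    apply hzP
    rw [← h.inf_eq_cent_of_card_eq hp hqp hq hq4 hx hxc hM hN hMN]
    exact ⟨hzM, hzN⟩
  have hnx : normCent x ∈ Solubilizer.maximalContaining x := hmax ▸ Or.inr rfl
  have hsub : borels x ⊆ Solubilizer.maximalContaining x := hmax ▸ Set.subset_union_left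
  have hsplit : Solubilizer.solubilizer x = (normCent x : Set G) ∪
      ⋃ M ∈ borels x, (M : Set G) \ (cent x : Set G) := by
    rw [h.solubilizer_eq hp hqp hq hq4, hmax]
    ext z
    simp only [Set.mem_iUnion, Set.mem_union, Set.mem_sdiff, exists_prop, Set.mem_singleton_iff]
    constructor
    · rintro ⟨M, hM | rfl, hz⟩
      · by_cases hzP : z ∈ (cent x : Set G)
        · exact Or.inl (cent_le_normCent x hzP)
        · exact Or.inr ⟨M, hM, hz, hzP⟩
      · exact Or.inl hz
    · rintro (hz | ⟨M, hM, hz, -⟩)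
      · exact ⟨_, Or.inr rfl, hz⟩
      · exact ⟨M, Or.inl hM, hz⟩
  have hd : Disjoint (normCent x : Set G) (⋃ M ∈ borels x, (M : Set G) \ (cent x : Set G)) := by
    rw [Set.disjoint_left]
    simp only [Set.mem_iUnion]
    rintro z hz ⟨M, hM, hzM, hzx⟩
    refine Set.disjoint_left.1 (hdis hnx (hsub hM) ?_) ⟨hz, hzx⟩ ⟨hzM, hzx⟩
    rintro rfl
    obtain ⟨u, hu1, hu, he, -⟩ := hM
    have := (h.cent_inj_of_normCent_eq (by omega) hx1 hu1).1 he
    exact h.mul_self_ne_of_commute hx hu1 (mem_cent.1 (this ▸ mem_cent.2 (Commute.refl u))) hu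
  have hN : (normCent x : Set G).ncard = 2 * (q - 1) := by
    rw [← hxc]; exact h.card_normCent hx
  rw [hsplit, Set.ncard_union_eq hd, hN,
    ncard_biUnion_const (hdis.subset hsub) (m := (q - 1) * q - (q - 1)),
    h.ncard_borels_of_card_eq hq hq4 hx hxc]
  · obtain ⟨m, rfl⟩ : ∃ m, q = m + 4 := ⟨q - 4, by omega⟩
    have e1 : m + 4 - 1 = m + 3 := by omega
    have e2 : (m + 3) * (m + 4) - (m + 3) = (m + 3) * (m + 3) :=
      Nat.sub_eq_of_eq_add (by ring)
    rw [e1, e2]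
    ring
  · rintro M hM
    have h1 := hle (hsub hM)
    obtain ⟨u, hu1, hu, rfl, hxu⟩ := hM
    rw [Set.ncard_sdiff h1, hC, ← h.card_normCent_of_sq hq (by omega) hu1 hu]
    rfl

theorem maximalContaining_eq_singleton [Finite G] {p : ℕ} (hp : p.Prime) (hqp : q = 2 ^ p)
    (hq : Even q) (hq4 : 4 ≤ q) {x : G} (hx : x * x ≠ 1) (hxc : Nat.card (cent x) = q + 1) :
    Solubilizer.maximalContaining x = {normCent x} := by
  rw [h.maximalContaining_eq hp hqp hq4, h.borels_eq_empty hq hq4 hx hxc,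
    h.torusNormalizers_eq_empty hx (n := q - 1) (by omega), ← hxc, h.torusNormalizers_eq hx,
    Set.empty_union, Set.empty_union]

end IsEvenSL2
end EvenSL2

/-! ### The main theorem -/

theorem theorem3p1 {F : Type*} [Field F] (p q : ℕ) (hp : p.Prime) (hq : q = 2 ^ p)
    (hF : Nat.card F = q) :
    -- the three rows exhaust the maximal subgroups
    (∀ M : Subgroup (Matrix.ProjectiveSpecialLinearGroup (Fin 2) F), IsCoatom M →
      Solubilizer.IsBorelType p M ∨ Solubilizer.IsDihedralType (q - 1) M ∨
        Solubilizer.IsDihedralType (q + 1) M) ∧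
    ∀ x : Matrix.ProjectiveSpecialLinearGroup (Fin 2) F, x ≠ 1 →
      -- the solubilizer is the union of the maximal subgroups containing `x`
      (Solubilizer.solubilizer x = ⋃ M ∈ Solubilizer.maximalContaining x,
        (M : Set (Matrix.ProjectiveSpecialLinearGroup (Fin 2) F))) ∧
      -- exactly one of the three columns applies
      ((orderOf x = 2 ∧ ¬ orderOf x ∣ q - 1 ∧ ¬ orderOf x ∣ q + 1) ∨
        (orderOf x ≠ 2 ∧ orderOf x ∣ q - 1 ∧ ¬ orderOf x ∣ q + 1) ∨
        (orderOf x ≠ 2 ∧ ¬ orderOf x ∣ q - 1 ∧ orderOf x ∣ q + 1)) ∧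
      -- the column `|x| = 2`
      (orderOf x = 2 →
        {M ∈ Solubilizer.maximalContaining x | Solubilizer.IsBorelType p M}.ncard = 1 ∧
        {M ∈ Solubilizer.maximalContaining x |
          Solubilizer.IsDihedralType (q - 1) M}.ncard = q / 2 ∧
        {M ∈ Solubilizer.maximalContaining x |
          Solubilizer.IsDihedralType (q + 1) M}.ncard = q / 2 ∧
        (∀ M ∈ Solubilizer.maximalContaining x, ∀ N ∈ Solubilizer.maximalContaining x, M ≠ N →
          Solubilizer.IsCyclicType 2 ↥(M ⊓ N)) ∧
        (Solubilizer.solubilizer x).ncard = 3 * q * (q - 1)) ∧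
      -- the column `|x| ∣ q - 1`
      (orderOf x ∣ q - 1 →
        {M ∈ Solubilizer.maximalContaining x | Solubilizer.IsBorelType p M}.ncard = 2 ∧
        {M ∈ Solubilizer.maximalContaining x |
          Solubilizer.IsDihedralType (q - 1) M}.ncard = 1 ∧
        {M ∈ Solubilizer.maximalContaining x |
          Solubilizer.IsDihedralType (q + 1) M}.ncard = 0 ∧
        (∀ M ∈ Solubilizer.maximalContaining x, ∀ N ∈ Solubilizer.maximalContaining x, M ≠ N →
          Solubilizer.IsCyclicType (q - 1) ↥(M ⊓ N)) ∧
        (Solubilizer.solubilizer x).ncard = 2 * q * (q - 1)) ∧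
      -- the column `|x| ∣ q + 1`, where there are no two distinct subgroups to intersect
      (orderOf x ∣ q + 1 →
        {M ∈ Solubilizer.maximalContaining x | Solubilizer.IsBorelType p M}.ncard = 0 ∧
        {M ∈ Solubilizer.maximalContaining x |
          Solubilizer.IsDihedralType (q - 1) M}.ncard = 0 ∧
        {M ∈ Solubilizer.maximalContaining x |
          Solubilizer.IsDihedralType (q + 1) M}.ncard = 1 ∧
        (∀ M ∈ Solubilizer.maximalContaining x, ∀ N ∈ Solubilizer.maximalContaining x, M = N) ∧
        (Solubilizer.solubilizer x).ncard = 2 * (q + 1)) := by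
  have hqe : Even q := by rw [hq]; exact (Nat.even_pow.2 ⟨even_two, hp.ne_zero⟩)
  have hq4 : 4 ≤ q := by
    rw [hq]
    exact Nat.pow_le_pow_right (n := 2) two_pos hp.two_le
  have hfin : Finite F := Nat.finite_of_card_ne_zero (by omega)
  have hchar : CharP F 2 := by
    have : Fintype F := Fintype.ofFinite F
    rw [Nat.card_eq_fintype_card] at hF
    obtain ⟨r, hr⟩ := CharP.exists F
    obtain ⟨n, hrp, hn⟩ := FiniteField.card F r
    have h2 : r ∣ 2 ^ p := by
      rw [← hq, ← hF, hn]
      exact dvd_pow_self r n.ne_zero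
    rwa [(Nat.prime_dvd_prime_iff_eq hrp Nat.prime_two).1 (hrp.dvd_of_dvd_pow h2)] at hr
  have h : EvenSL2.IsEvenSL2 q (Matrix.ProjectiveSpecialLinearGroup (Fin 2) F) :=
    hF ▸ EvenSL2.isEvenSL2_psl
  have hfin' : Finite (Matrix.ProjectiveSpecialLinearGroup (Fin 2) F) := inferInstance
  refine ⟨fun M hM ↦ ?_, fun x hx1 ↦ ⟨h.solubilizer_eq hp hq hqe hq4 x, ?_, ?_, ?_, ?_⟩⟩
  · obtain ⟨z, hz1, rfl⟩ := (h.isCoatom_iff hp hq (by omega)).1 hM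
    by_cases hz : z * z = 1
    · exact Or.inl (h.isBorelType hq hqe hq4 hz1 hz)
    · have := h.isDihedralType hz
      rcases h.card_of_not_sq z hz with hc | hc
      · exact Or.inr (Or.inl (hc ▸ this))
      · exact Or.inr (Or.inr (hc ▸ this))
  · rcases h.orderOf_cases hqe (by omega) hx1 with hx | hx | hx
    · exact Or.inl hx.2
    · exact Or.inr (Or.inl hx.2.2)
    · exact Or.inr (Or.inr hx.2.2)
  · intro h2
    have hx : x * x = 1 := by
      rw [← pow_two]; exact orderOf_dvd_iff_pow_eq_one.1 h2.dvd
    rw [h.setOf_isBorelType hp hq hqe hq4, h.setOf_isDihedralType hp hq hqe hq4 x (Or.inl rfl),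
      h.setOf_isDihedralType hp hq hqe hq4 x (Or.inr rfl), h.borels_eq_singleton hx1 hx]
    exact ⟨Set.ncard_singleton _, h.ncard_torusNormalizers_sub hqe hq4 hx1 hx,
      h.ncard_torusNormalizers_add hqe hq4 hx1 hx,
      fun M hM N hN hMN ↦ h.isCyclicType_two hp hq hq4 hx1 hx hM hN hMN,
      h.ncard_solubilizer_involution hp hq hqe hq4 hx1 hx⟩
  · intro hd
    obtain ⟨hx, hxc⟩ : x * x ≠ 1 ∧ Nat.card (EvenSL2.cent x) = q - 1 := by
      rcases h.orderOf_cases hqe (by omega) hx1 with hx | hx | hx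
      · exact absurd hd hx.2.2.1
      · exact ⟨hx.1, hx.2.1⟩
      · exact absurd hd hx.2.2.2.1
    rw [h.setOf_isBorelType hp hq hqe hq4, h.setOf_isDihedralType hp hq hqe hq4 x (Or.inl rfl),
      h.setOf_isDihedralType hp hq hqe hq4 x (Or.inr rfl),
      h.torusNormalizers_eq_empty hx (n := q + 1) (by omega), Set.ncard_empty]
    refine ⟨h.ncard_borels_of_card_eq hqe hq4 hx hxc, ?_, rfl, fun M hM N hN hMN ↦ ?_,
      h.ncard_solubilizer_sub hp hq hqe hq4 hx hxc⟩
    · rw [← hxc, h.torusNormalizers_eq hx, Set.ncard_singleton]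
    · rw [h.inf_eq_cent_of_card_eq hp hq hqe hq4 hx hxc hM hN hMN]
      exact EvenSL2.isCyclicType_of_isCyclic (h.isCyclic x hx) hxc
  · intro hd
    obtain ⟨hx, hxc⟩ : x * x ≠ 1 ∧ Nat.card (EvenSL2.cent x) = q + 1 := by
      rcases h.orderOf_cases hqe (by omega) hx1 with hx | hx | hx
      · exact absurd hd hx.2.2.2
      · exact absurd hd hx.2.2.2.2
      · exact ⟨hx.1, hx.2.1⟩
    have hmax := h.maximalContaining_eq_singleton hp hq hqe hq4 hx hxc
    rw [h.setOf_isBorelType hp hq hqe hq4, h.setOf_isDihedralType hp hq hqe hq4 x (Or.inl rfl),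
      h.setOf_isDihedralType hp hq hqe hq4 x (Or.inr rfl),
      h.torusNormalizers_eq_empty hx (n := q - 1) (by omega), Set.ncard_empty,
      h.borels_eq_empty hqe hq4 hx hxc, Set.ncard_empty, ← hxc, h.torusNormalizers_eq hx,
      Set.ncard_singleton]
    refine ⟨rfl, rfl, rfl, fun M hM N hN ↦ ?_, ?_⟩
    · rw [hmax] at hM hN
      exact hM.trans hN.symm
    · rw [h.solubilizer_eq hp hq hqe hq4, hmax, Set.biUnion_singleton]
      exact h.card_normCent hx
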